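/- Let $G$ be a finite graph. A set $S\subseteq V(G)$ is \emph{$P_3$-closed} if every vertex outside $S$ has fewer than two neighbours in $S$; the hull $\sigma(A)$ of $A\subseteq V(G)$ is the intersection of all $P_3$-closed sets containing $A$. In the \emph{connected $P_3$-game} on $G$, a position is a $P_3$-closed set $L$ of labeled vertices that is empty or induces a connected subgraph. The game starts with $L=\varnothing$. Two players alternately select an unlabeled vertex $x$ such that $\sigma(L\cup\{x\})$ induces a connected subgraph, and this set becomes the new set of labeled vertices; a player who has no legal move loses. The Grundy value of a position is the least nonnegative integer that is not the Grundy value of a position reachable in one move. Theorem. (1) There is a polynomial-time algorithm that, given a tree $T$, decides whether the first player has a winning strategy in the connected $P_3$-game on $T$. (2) There is a polynomial-time algorithm that, given a tree $T$ and a nonempty position $L$ (a labeled subtree), computes the Grundy value of $L$ in the game on $T$; in particular this applies when $T$ is a branch (as in (3)) of which only the root is labeled. (3) Let $L$ be a nonempty position in a finite tree $T$, and let $B_1,\dots,B_\ell$ be its branches, that is, the maximal subtrees of $T$ that contain exactly one vertex of $L$, called the root, and have it as a leaf (with exactly one incident edge). Let $g_i$ be the Grundy value of the game on the tree $B_i$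 in the position in which exactly the root is labeled. Then the Grundy value of $L$ is the nim-sum (binary addition without carry) $g_1\oplus\dots\oplus g_\ell$. Here a polynomial-time algorithm is a program of a random access machine (registers, indirectly addressed memory, addition and truncated subtraction of natural numbers at unit cost, conditionals and loops) whose number of steps is at most a polynomial in the number $n$ of vertices of the tree, which is given by $n$, its adjacency matrix and the indicator vector of the labeled set. -/

import Mathlib

/-! ## The connected `P₃`-game on a graph -/

namespace P3Game

section Game

variable {V : Type*}

/-- `S` is `P₃`-closed: every vertex outside `S` has fewer than two neighbours in `S`. -/
def IsP3Closed (G : SimpleGraph V) (S : Set V) : Prop :=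
  ∀ x, x ∉ S → (G.neighborSet x ∩ S).encard < 2

/-- The hull `σ(A)`: the intersection of all `P₃`-closed sets containing `A`. -/
def hull (G : SimpleGraph V) (A : Set V) : Set V :=
  ⋂₀ {K | IsP3Closed G K ∧ A ⊆ K}

theorem subset_hull (G : SimpleGraph V) (A : Set V) : A ⊆ hull G A :=
  fun _ ha _ hK => hK.2 ha

/-- A position (playground) of the connected `P₃`-game on `G`: the set `L` of labeled vertices is
`P₃`-closed and induces a connected subgraph. The empty set, with which the game starts, is allowed
(hence `Preconnected`). -/
def IsPosition (G : SimpleGraph V) (L : Set V) : Prop :=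
  IsP3Closed G L ∧ (G.induce L).Preconnected

/-- The labeled set after the vertex `x` has been selected in position `L`. -/
def move (G : SimpleGraph V) (L : Set V) (x : V) : Set V :=
  hull G (insert x L)

/-- Selecting `x` is legal in position `L`: `x` is unlabeled, and the new labeled set induces a
connected subgraph. -/
def IsLegal (G : SimpleGraph V) (L : Set V) (x : V) : Prop :=
  x ∉ L ∧ (G.induce (move G L x)).Connected

theorem IsLegal.ssubset_move {G : SimpleGraph V} {L : Set V} {x : V} (h : IsLegal G L x) :
    L ⊂ move G L x :=
  (Set.ssubset_insert h.1).trans_subset (subset_hull G _)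

theorem IsLegal.ncard_compl_lt [Finite V] {G : SimpleGraph V} {L : Set V} {x : V}
    (h : IsLegal G L x) : (move G L x)ᶜ.ncard < Lᶜ.ncard :=
  Set.ncard_lt_ncard (compl_lt_compl_iff_lt.mpr h.ssubset_move) (Set.toFinite _)

/-- The strategy `s` (a choice of a vertex for each position) wins for the player who is to move in
position `L`, under the normal play convention (a player without a legal move loses): the move
prescribed by `s` is legal, and after every legal answer of the opponent `s` wins again. -/
inductive WinsWith (G : SimpleGraph V) (s : Set V → V) : Set V → Prop
  | intro (L : Set V) (legal : IsLegal G L (s L))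
      (answer : ∀ y, IsLegal G (move G L (s L)) y →
        WinsWith G s (move G (move G L (s L)) y)) :
      WinsWith G s L

/-- The first player has a winning strategy in the connected `P₃`-game on `G`. -/
def FirstPlayerWins (G : SimpleGraph V) : Prop :=
  ∃ s : Set V → V, WinsWith G s ∅

/-- The Grundy value of a position: the least natural number that is not the Grundy value of any
position that can be reached in one legal move. -/
noncomputable def grundy [Finite V] (G : SimpleGraph V) (L : Set V) : ℕ :=
  sInf {n | ∀ x, (h : IsLegal G L x) → grundy G (move G L x) ≠ n}
termination_by Lᶜ.ncard
decreasing_by exact h.ncard_compl_lt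

/-- `B` is (the vertex set of) a subtree that contains exactly one labeled vertex `u`, and `u` is a
leaf of it. -/
def IsHanging (G : SimpleGraph V) (L B : Set V) : Prop :=
  (G.induce B).Connected ∧ ∃ u, B ∩ L = {u} ∧ ∃! v, v ∈ B ∧ G.Adj u v

/-- A branch (with at least one edge) of the position `L`: a maximal subtree that contains exactly
one labeled vertex, its root, and has it as a leaf. -/
def IsBranch (G : SimpleGraph V) (L B : Set V) : Prop :=
  Maximal (IsHanging G L) B

/-- The set of branches of the position `L`. -/
noncomputable def branches [Finite V] (G : SimpleGraph V) (L : Set V) : Finset (Set V) :=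
  (Set.toFinite {B | IsBranch G L B}).toFinset

/-- The Grundy value of the game on the branch `B` in which only the root is labeled. -/
noncomputable def branchGrundy [Finite V] (G : SimpleGraph V) (L B : Set V) : ℕ :=
  grundy (G.induce B) {x : B | x.1 ∈ L}

end Game

/-- The nim-sum `⊕_{i ∈ s} f i` (binary addition without carry). -/
def nimSum {ι : Type*} (s : Finset ι) (f : ι → ℕ) : ℕ :=
  s.fold (fun a b : ℕ => a ^^^ b) 0 f

end P3Game

/-! ## Random access machines with a step count -/

namespace RAM

/-- The state of a random access machine: registers, which a program names directly, and memory
cells, which it reaches through addresses held in registers. All of them hold natural numbers. -/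
structure State where
  reg : ℕ → ℕ
  mem : ℕ → ℕ

def State.setReg (s : State) (r v : ℕ) : State :=
  { s with reg := Function.update s.reg r v }

def State.setMem (s : State) (a v : ℕ) : State :=
  { s with mem := Function.update s.mem a v }

/-- Programs of a random access machine in structured form. The arithmetic is addition and
(truncated) subtraction only, so that the unit cost measure below is polynomially equivalent to
the running time of Turing machines. -/
inductive Program
  /-- `R[r] := k` -/
  | const (r k : ℕ)
  /-- `R[r] := R[a] + R[b]` -/
  | add (r a b : ℕ)
  /-- `R[r] := R[a] - R[b]`, or `0` if `R[a] < R[b]` -/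
  | sub (r a b : ℕ)
  /-- `R[r] := M[R[a]]` -/
  | load (r a : ℕ)
  /-- `M[R[a]] := R[r]` -/
  | store (a r : ℕ)
  /-- `P; Q` -/
  | seq (P Q : Program)
  /-- `if R[r] ≠ 0 then P else Q` -/
  | cond (r : ℕ) (P Q : Program)
  /-- `while R[r] ≠ 0 do P` -/
  | loop (r : ℕ) (P : Program)

/-- `Run P s t s'`: started in state `s`, the program `P` halts in state `s'` after exactly `t`
steps. Each elementary instruction and each test costs one step. -/
inductive Run : Program → State → ℕ → State → Prop
  | const (r k : ℕ) (s : State) : Run (.const r k) s 1 (s.setReg r k)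
  | add (r a b : ℕ) (s : State) : Run (.add r a b) s 1 (s.setReg r (s.reg a + s.reg b))
  | sub (r a b : ℕ) (s : State) : Run (.sub r a b) s 1 (s.setReg r (s.reg a - s.reg b))
  | load (r a : ℕ) (s : State) : Run (.load r a) s 1 (s.setReg r (s.mem (s.reg a)))
  | store (a r : ℕ) (s : State) : Run (.store a r) s 1 (s.setMem (s.reg a) (s.reg r))
  | seq {P Q : Program} {s s₁ s₂ : State} {t₁ t₂ : ℕ} :
      Run P s t₁ s₁ → Run Q s₁ t₂ s₂ → Run (.seq P Q) s (t₁ + t₂) s₂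
  | cond_true {r : ℕ} {P Q : Program} {s s₁ : State} {t : ℕ} :
      s.reg r ≠ 0 → Run P s t s₁ → Run (.cond r P Q) s (1 + t) s₁
  | cond_false {r : ℕ} {P Q : Program} {s s₁ : State} {t : ℕ} :
      s.reg r = 0 → Run Q s t s₁ → Run (.cond r P Q) s (1 + t) s₁
  | loop_done {r : ℕ} {P : Program} {s : State} :
      s.reg r = 0 → Run (.loop r P) s 1 s
  | loop_step {r : ℕ} {P : Program} {s s₁ s₂ : State} {t₁ t₂ : ℕ} :
      s.reg r ≠ 0 → Run P s t₁ s₁ → Run (.loop r P) s₁ t₂ s₂ →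
        Run (.loop r P) s (1 + t₁ + t₂) s₂

/-- The machine is deterministic: running time and final state are unique. -/
theorem Run.unique {P : Program} {s s₁ s₂ : State} {t₁ t₂ : ℕ}
    (h₁ : Run P s t₁ s₁) (h₂ : Run P s t₂ s₂) : t₁ = t₂ ∧ s₁ = s₂ := by
  induction h₁ generalizing t₂ s₂ with
  | const | add | sub | load | store => cases h₂; exact ⟨rfl, rfl⟩
  | seq _ _ ih₁ ih₂ =>
    cases h₂ with
    | seq a b =>
      obtain ⟨rfl, rfl⟩ := ih₁ a
      obtain ⟨rfl, rfl⟩ := ih₂ b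
      exact ⟨rfl, rfl⟩
  | cond_true h _ ih =>
    cases h₂ with
    | cond_true _ a => obtain ⟨rfl, rfl⟩ := ih a; exact ⟨rfl, rfl⟩
    | cond_false h' _ => exact absurd h' h
  | cond_false h _ ih =>
    cases h₂ with
    | cond_true h' _ => exact absurd h h'
    | cond_false _ a => obtain ⟨rfl, rfl⟩ := ih a; exact ⟨rfl, rfl⟩
  | loop_done h =>
    cases h₂ with
    | loop_done _ => exact ⟨rfl, rfl⟩
    | loop_step h' _ _ => exact absurd h h'
  | loop_step h _ _ ih₁ ih₂ =>
    cases h₂ with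
    | loop_done h' => exact absurd h' h
    | loop_step _ a b =>
      obtain ⟨rfl, rfl⟩ := ih₁ a
      obtain ⟨rfl, rfl⟩ := ih₂ b
      exact ⟨rfl, rfl⟩

/-- Started in state `s`, the program `P` halts within `T` steps with output `v` in register `0`. -/
def Outputs (P : Program) (s : State) (T v : ℕ) : Prop :=
  ∃ t s', Run P s t s' ∧ t ≤ T ∧ s'.reg 0 = v

open Classical in
/-- The input state for a graph on `{0, …, n - 1}` with a set `L` of labeled vertices: register `0`
holds `n`, the cells `0, …, n² - 1` hold the adjacency matrix row by row, the next `n` cells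
hold the indicator vector of `L`; everything else is `0`. -/
noncomputable def input {n : ℕ} (G : SimpleGraph (Fin n)) (L : Set (Fin n)) : State where
  reg r := if r = 0 then n else 0
  mem a := if (∃ i j : Fin n, G.Adj i j ∧ a = i.1 * n + j.1) ∨ (∃ i ∈ L, a = n * n + i.1)
    then 1 else 0

end RAM

/-! ### Closure properties of polynomial-time machine computations -/

namespace RAM

/-! In a tree every connected set is `P₃`-closed, so nonempty positions are subtrees. From such an
`L`, a legal move either labels a vertex `v` adjacent to some `u ∈ L`, or selects a further
neighbour `w` of `v` and labels `v` and `w` together; a vertex farther away is its own addition to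
the hull and disconnects it (`IsLegal.exists_adj`). Hence a move touches only the branch at one edge
`uv` leaving `L`, and labeling `v` replaces that edge by the edges from `v` to its other neighbours.

Let `F u v` be the value of the branch at `uv`, and `R u v` the nim-sum of `F v w` over neighbours
`w ≠ u` of `v`. The options of the branch have values `R u v` and `R u v ⊕ F v w ⊕ R v w`, so `F u
v` is their mex. The recursion is well-founded, because the side of an edge shrinks as one moves
outwards. The Sprague–Grundy argument shows that any `F` obeying it computes the value of `L` as the
nim-sum over the edges leaving `L` (`grundy_eq_nimSum_boundary`). Applied in `G` and again inside a
single branch, where the same `F` obeys the recursion, this gives the decomposition into branches.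

For the algorithm, keep a table of `F` for all pairs `(u, v)` and recompute all of it `n` times:
each sweep makes at least one more rank correct, the rank of `uv` being the number of vertices
beyond it. A branch has at most `n` options, so the entries are at most `n` and the mex search needs
`n` rounds; nim-sums fit into `n` bits and are computed by addition and subtraction. The first
player wins iff some singleton has value `0`. The time bounds come from closure properties:
polynomial-time computations on the machine are closed under arithmetic, branching and loops of
length `n` (`Comp`, `Exec`). -/

@[simp] theorem State.setReg_reg (s : State) (r v : ℕ) :
    (s.setReg r v).reg = Function.update s.reg r v := rfl

@[simp] theorem State.setReg_mem (s : State) (r v : ℕ) : (s.setReg r v).mem = s.mem := rfl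

@[simp] theorem State.setMem_mem (s : State) (a v : ℕ) :
    (s.setMem a v).mem = Function.update s.mem a v := rfl

/-- Two states have the same memory and the same contents of the registers below `k`. -/
def Agree (k : ℕ) (s s' : State) : Prop :=
  s.mem = s'.mem ∧ ∀ r < k, s.reg r = s'.reg r

theorem Agree.refl (k : ℕ) (s : State) : Agree k s s :=
  ⟨rfl, fun _ _ => rfl⟩

theorem Agree.trans {k : ℕ} {s₁ s₂ s₃ : State} (h : Agree k s₁ s₂) (h' : Agree k s₂ s₃) :
    Agree k s₁ s₃ :=
  ⟨h.1.trans h'.1, fun r hr => (h.2 r hr).trans (h'.2 r hr)⟩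

theorem Agree.mono {k k' : ℕ} {s s' : State} (h : Agree k' s s') (hk : k ≤ k') : Agree k s s' :=
  ⟨h.1, fun r hr => h.2 r (hr.trans_le hk)⟩

theorem Agree.setReg {k : ℕ} {s s' : State} (h : Agree k s s') {r : ℕ} (hr : k ≤ r) (v : ℕ) :
    Agree k (s.setReg r v) s' :=
  ⟨h.1, fun q hq => by simp [Function.update_of_ne (hq.trans_le hr).ne, h.2 q hq]⟩

/-- A context: a way in which the memory and the registers below `lvl` of a state represent an
object `a : α`, where register `0` holds the size of `a`. -/
structure Ctx (α : Type*) where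
  rel : α → State → Prop
  lvl : ℕ
  size : α → ℕ
  mem : α → ℕ → ℕ
  lvl_pos : 0 < lvl
  reg_zero : ∀ {a s}, rel a s → s.reg 0 = size a
  mem_eq : ∀ {a s}, rel a s → s.mem = mem a
  of_agree : ∀ {a s s'}, rel a s → Agree lvl s' s → rel a s'

/-- The context in which, in addition, the register number `lvl + j` holds a value. -/
def Ctx.ext {α : Type*} (C : Ctx α) (j : ℕ) : Ctx (α × ℕ) where
  rel x s := C.rel x.1 s ∧ s.reg (C.lvl + j) = x.2
  lvl := C.lvl + j + 1
  size x := C.size x.1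
  mem x := C.mem x.1
  lvl_pos := Nat.succ_pos _
  reg_zero h := C.reg_zero h.1
  mem_eq h := C.mem_eq h.1
  of_agree h h' := ⟨C.of_agree h.1 (h'.mono (by omega)), (h'.2 _ (by omega)).trans h.2⟩

/-- The context in which the memory and register `0` are those of a given state. -/
def Ctx.base : Ctx State where
  rel a s := Agree 1 s a
  lvl := 1
  size a := a.reg 0
  mem a := a.mem
  lvl_pos := Nat.one_pos
  reg_zero h := h.2 0 Nat.one_pos
  mem_eq h := h.1
  of_agree h h' := h'.trans h

/-- `step 0 (step 1 (… (step (n - 1) b)))` -/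
def dfold {β : Type*} : ℕ → (ℕ → β → β) → β → β
  | 0, _, b => b
  | n + 1, step, b => dfold n step (step n b)

/-- The index in the invariant counts down, from `n` before the loop to `0` after it, as the
machine's counter does. -/
theorem dfold_induction {β : Type*} {n : ℕ} {step : ℕ → β → β} {b : β} (I : ℕ → β → Prop)
    (h0 : I n b) (h : ∀ i < n, ∀ b, I (i + 1) b → I i (step i b)) : I 0 (dfold n step b) := by
  induction n generalizing b with
  | zero => exact h0
  | succ n ih => exact ih (h n n.lt_succ_self b h0) fun i hi => h i (by omega)

/-- A loop whose counter register `c` is decremented by its body terminates, and preserves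
the invariants of its body. -/
theorem Run.exists_loop {c T : ℕ} {P : Program} {I : ℕ → State → Prop}
    (hc : ∀ j s, I j s → s.reg c = j)
    (h : ∀ j s, I (j + 1) s → ∃ τ s', Run P s τ s' ∧ τ ≤ T ∧ I j s') (j : ℕ) (s : State)
    (hs : I j s) : ∃ τ s', Run (.loop c P) s τ s' ∧ τ ≤ j * (T + 1) + 1 ∧ I 0 s' := by
  induction j generalizing s with
  | zero => exact ⟨1, s, .loop_done (hc _ _ hs), by omega, hs⟩
  | succ j ih =>
    obtain ⟨τ₁, s₁, h₁, hτ₁, hs₁⟩ := h j s hs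
    obtain ⟨τ₂, s₂, h₂, hτ₂, hs₂⟩ := ih s₁ hs₁
    refine ⟨_, s₂, .loop_step (by rw [hc _ _ hs]; omega) h₁ h₂, ?_, hs₂⟩
    rw [Nat.succ_mul]; omega

/-- The function `f` of the object that the context represents can be computed into any register
`t ≥ lvl` in time polynomial in the size, without changing the memory and the registers
below `t`. -/
def Comp {α : Type*} (C : Ctx α) (f : α → ℕ) : Prop :=
  ∀ t, C.lvl ≤ t → ∃ (P : Program) (p : Polynomial ℕ), ∀ a s, C.rel a s →
    ∃ τ s', Run P s τ s' ∧ τ ≤ p.eval (C.size a) ∧ s'.reg t = f a ∧ Agree t s' s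

/-- A decidable relation of the context: its characteristic function can be computed. -/
def Dec (C : Ctx α) (q : α → Prop) : Prop :=
  ∃ f : α → ℕ, Comp C f ∧ ∀ a, f a ≠ 0 ↔ q a

namespace Comp

variable {α β : Type*} {C : Ctx α}

theorem lift {f : α → ℕ} (hf : Comp C f) (j : ℕ) : Comp (C.ext j) fun x => f x.1 := by
  intro t ht
  obtain ⟨P, p, h⟩ := hf t ((by simp [Ctx.ext]; omega : C.lvl ≤ (C.ext j).lvl).trans ht)
  exact ⟨P, p, fun x s hs => h x.1 s hs.1⟩

theorem const (c : ℕ) : Comp C fun _ => c := fun t _ =>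
  ⟨.const t c, 1, fun _ s _ =>
    ⟨1, _, .const t c s, by simp, by simp, (Agree.refl t s).setReg le_rfl c⟩⟩

/-- There is no move instruction: a copy is an addition to a register that has been set to `0`. -/
theorem var {f : α → ℕ} (r : ℕ) (hr : r < C.lvl) (h : ∀ a s, C.rel a s → s.reg r = f a) :
    Comp C f := fun t ht =>
  ⟨.seq (.const t 0) (.add t r t), 2, fun a s hs =>
    ⟨_, _, .seq (.const t 0 s) (.add t r t _), by simp,
      by simp [Function.update_of_ne (hr.trans_le ht).ne, h a s hs],
      ((Agree.refl t s).setReg le_rfl _).setReg le_rfl _⟩⟩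

theorem last (j : ℕ) : Comp (C.ext j) fun x => x.2 :=
  var (C.lvl + j) (Nat.lt_succ_self _) fun _ _ h => h.2

theorem size : Comp C C.size :=
  var 0 C.lvl_pos fun _ _ h => C.reg_zero h

/-- Two values can be computed into consecutive registers. -/
theorem pair {f g : α → ℕ} (hf : Comp C f) (hg : Comp C g) (t : ℕ) (ht : C.lvl ≤ t) :
    ∃ (P : Program) (p : Polynomial ℕ), ∀ a s, C.rel a s →
      ∃ τ s', Run P s τ s' ∧ τ ≤ p.eval (C.size a) ∧ s'.reg t = f a ∧ s'.reg (t + 1) = g a ∧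
        Agree t s' s := by
  obtain ⟨P, p, h⟩ := hf t ht
  obtain ⟨Q, q, h'⟩ := hg (t + 1) (by omega)
  refine ⟨.seq P Q, p + q, fun a s hs => ?_⟩
  obtain ⟨τ₁, s₁, r₁, b₁, v₁, e₁⟩ := h a s hs
  obtain ⟨τ₂, s₂, r₂, b₂, v₂, e₂⟩ := h' a s₁ (C.of_agree hs (e₁.mono ht))
  refine ⟨_, s₂, .seq r₁ r₂, by simp; omega, by rw [e₂.2 t (by omega), v₁], v₂,
    (e₂.mono (by omega)).trans e₁⟩

theorem add {f g : α → ℕ} (hf : Comp C f) (hg : Comp C g) : Comp C fun a => f a + g a := by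
  intro t ht
  obtain ⟨P, p, h⟩ := hf.pair hg t ht
  refine ⟨.seq P (.add t t (t + 1)), p + 1, fun a s hs => ?_⟩
  obtain ⟨τ, s', r, b, v, w, e⟩ := h a s hs
  exact ⟨_, _, .seq r (.add _ _ _ _), by simp; omega, by simp [v, w], e.setReg le_rfl _⟩

theorem sub {f g : α → ℕ} (hf : Comp C f) (hg : Comp C g) : Comp C fun a => f a - g a := by
  intro t ht
  obtain ⟨P, p, h⟩ := hf.pair hg t ht
  refine ⟨.seq P (.sub t t (t + 1)), p + 1, fun a s hs => ?_⟩
  obtain ⟨τ, s', r, b, v, w, e⟩ := h a s hs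
  exact ⟨_, _, .seq r (.sub _ _ _ _), by simp; omega, by simp [v, w], e.setReg le_rfl _⟩

theorem load {f : α → ℕ} (hf : Comp C f) : Comp C fun a => C.mem a (f a) := by
  intro t ht
  obtain ⟨P, p, h⟩ := hf t ht
  refine ⟨.seq P (.load t t), p + 1, fun a s hs => ?_⟩
  obtain ⟨τ, s', r, b, v, e⟩ := h a s hs
  exact ⟨_, _, .seq r (.load _ _ _), by simp; omega, by simp [v, e.1, C.mem_eq hs],
    e.setReg le_rfl _⟩

theorem ite {q : α → Prop} [DecidablePred q] {f g : α → ℕ} (hq : Dec C q) (hf : Comp C f)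
    (hg : Comp C g) : Comp C fun a => if q a then f a else g a := by
  intro t ht
  obtain ⟨c, hc, hcq⟩ := hq
  obtain ⟨P₀, p₀, h₀⟩ := hc t ht
  obtain ⟨P₁, p₁, h₁⟩ := hf t ht
  obtain ⟨P₂, p₂, h₂⟩ := hg t ht
  refine ⟨.seq P₀ (.cond t P₁ P₂), p₀ + (1 + p₁ + p₂), fun a s hs => ?_⟩
  obtain ⟨τ, s', r, b, v, e⟩ := h₀ a s hs
  have hs' := C.of_agree hs (e.mono ht)
  by_cases hqa : q a
  · obtain ⟨τ₁, s₁, r₁, b₁, v₁, e₁⟩ := h₁ a s' hs'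
    refine ⟨_, _, .seq r (.cond_true (by rw [v]; exact (hcq a).2 hqa) r₁), ?_, by simp [v₁, hqa],
      e₁.trans e⟩
    simp; omega
  · obtain ⟨τ₁, s₁, r₁, b₁, v₁, e₁⟩ := h₂ a s' hs'
    refine ⟨_, _, .seq r (.cond_false ?_ r₁), ?_, by simp [v₁, hqa], e₁.trans e⟩
    · rw [v]; exact not_not.mp (mt (hcq a).1 hqa)
    · simp; omega

/-- Subtraction is truncated, so `g a - f a` is nonzero exactly when `f a < g a`; the other tests
are built from the same device. -/
theorem _root_.RAM.Dec.lt {f g : α → ℕ} (hf : Comp C f) (hg : Comp C g) : Dec C fun a => f a < g a :=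
  ⟨_, hg.sub hf, fun a => by omega⟩

theorem _root_.RAM.Dec.ne {f g : α → ℕ} (hf : Comp C f) (hg : Comp C g) : Dec C fun a => f a ≠ g a :=
  ⟨_, (hf.sub hg).add (hg.sub hf), fun a => by omega⟩

theorem _root_.RAM.Dec.not {q : α → Prop} (hq : Dec C q) : Dec C fun a => ¬ q a := by
  obtain ⟨f, hf, h⟩ := hq
  refine ⟨_, (const 1).sub hf, fun a => ?_⟩
  dsimp only
  rw [← h]; omega

theorem _root_.RAM.Dec.and {q r : α → Prop} (hq : Dec C q) (hr : Dec C r) : Dec C fun a => q a ∧ r a := by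
  obtain ⟨f, hf, h⟩ := hq
  obtain ⟨g, hg, h'⟩ := hr
  refine ⟨_, (const 1).sub (((const 1).sub hf).add ((const 1).sub hg)), fun a => ?_⟩
  dsimp only
  rw [← h, ← h']; omega

theorem _root_.RAM.Dec.eq {f g : α → ℕ} (hf : Comp C f) (hg : Comp C g) : Dec C fun a => f a = g a :=
  ⟨_, (const 1).sub ((hf.sub hg).add (hg.sub hf)), fun a => by omega⟩

/-- Closure under iteration `size` many times, with a single accumulator. -/
theorem dfold {f : α → ℕ} {step : α → ℕ → ℕ → ℕ} (hf : Comp C f)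
    (h : ∀ j, Comp ((C.ext j).ext 0) fun x => step x.1.1 x.2 x.1.2) :
    Comp C fun a => RAM.dfold (C.size a) (step a) (f a) := by
  intro t ht
  -- The accumulator lives in the target register `t = C.lvl + j` and the counter in `t + 1`. As `t`
  -- is arbitrary, the body must be computable in `(C.ext j).ext 0` for every gap `j`.
  obtain ⟨j, rfl⟩ := Nat.exists_eq_add_of_le ht
  obtain ⟨P, p, hP⟩ := hf _ ht
  obtain ⟨Q, q, hQ⟩ := h j (C.lvl + j + 2) le_rfl
  set t := C.lvl + j with htdef
  have ht0 := C.lvl_pos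
  -- The counter is decremented before the body runs, so the body sees `n - 1, …, 0`, the order of
  -- `dfold`.
  refine ⟨.seq P (.seq (.const (t + 1) 0) (.seq (.add (t + 1) 0 (t + 1)) (.loop (t + 1)
    (.seq (.const (t + 2) 1) (.seq (.sub (t + 1) (t + 1) (t + 2)) (.seq Q
      (.seq (.const (t + 3) 0) (.add t (t + 2) (t + 3)))))))))
    , p + (2 + (Polynomial.X * (4 + q + 1) + 1)), fun a s hs => ?_⟩
  obtain ⟨τ, s₁, r, b, v, e⟩ := hP a s hs
  let s₂ := (s₁.setReg (t + 1) 0).setReg (t + 1) (C.size a)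
  have hs₁ := C.of_agree hs (e.mono ht)
  have r₂ : Run (.add (t + 1) 0 (t + 1)) (s₁.setReg (t + 1) 0) 1 s₂ := by
    have := Run.add (t + 1) 0 (t + 1) (s₁.setReg (t + 1) 0)
    have h0 : s₁.reg 0 = C.size a := C.reg_zero hs₁
    simpa [s₂, h0] using this
  -- Invariant: running the remaining `i` rounds on the current accumulator yields the final value.
  let I : ℕ → State → Prop := fun i s' => i ≤ C.size a ∧ s'.reg (t + 1) = i ∧ Agree t s' s ∧
    RAM.dfold i (step a) (s'.reg t) = RAM.dfold (C.size a) (step a) (f a)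
  obtain ⟨τ₃, s₃, r₃, b₃, -, -, e₃, v₃⟩ := Run.exists_loop (I := I) (c := t + 1)
    (T := 4 + q.eval (C.size a))
    (P := .seq (.const (t + 2) 1) (.seq (.sub (t + 1) (t + 1) (t + 2)) (.seq Q
      (.seq (.const (t + 3) 0) (.add t (t + 2) (t + 3)))))) (fun i s' h => h.2.1) (by
    rintro i s' ⟨hi, hc, he, hv⟩
    let s₄ := (s'.setReg (t + 2) 1).setReg (t + 1) i
    have he₄ : Agree t s₄ s := (he.setReg (by omega) _).setReg (by omega) _
    have ht₄ : s₄.reg t = s'.reg t := by simp [s₄]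
    obtain ⟨τ₅, s₅, r₅, b₅, v₅, e₅⟩ := hQ ((a, s'.reg t), i) s₄
      ⟨⟨C.of_agree hs (he₄.mono ht), ht₄⟩, by simp [s₄, Ctx.ext, t]⟩
    refine ⟨1 + (1 + (τ₅ + (1 + 1))), (s₅.setReg (t + 3) 0).setReg t (s₅.reg (t + 2)),
      .seq (.const _ _ _) (.seq (s₁ := s₄) ?_ (.seq r₅ (.seq (.const _ _ _) ?_))), ?_, ?_⟩
    · have := Run.sub (t + 1) (t + 1) (t + 2) (s'.setReg (t + 2) 1)
      simpa [hc] using this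
    · have := Run.add t (t + 2) (t + 3) (s₅.setReg (t + 3) 0)
      simpa using this
    · simp only [Ctx.ext] at b₅; omega
    · refine ⟨by omega, ?_, ?_, ?_⟩
      · simpa [s₄] using e₅.2 (t + 1) (by omega)
      · exact (((e₅.mono (by omega)).trans he₄).setReg (by omega) _).setReg le_rfl _
      · rw [← hv]; simp [v₅, RAM.dfold])
    (C.size a) s₂ ⟨le_rfl, by simp [s₂], (e.setReg (by omega) _).setReg (by omega) _,
      by simp [s₂, v]⟩
  refine ⟨_, s₃, .seq r (.seq (.const _ _ _) (.seq r₂ r₃)), ?_, v₃, e₃⟩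
  simp; omega

end Comp

/-- There is a program that, in polynomial time, turns states that represent `a` in the
context `C` into states that represent `φ a` in the context `D`, without changing the registers below
the level of `C`. -/
def Exec {α β : Type*} (C : Ctx α) (D : Ctx β) (φ : α → β) : Prop :=
  ∃ (P : Program) (p : Polynomial ℕ), ∀ a s, C.rel a s →
    ∃ τ s', Run P s τ s' ∧ τ ≤ p.eval (C.size a) ∧ D.rel (φ a) s' ∧
      ∀ r < C.lvl, s'.reg r = s.reg r

namespace Exec

variable {α β γ : Type*} {C : Ctx α} {D : Ctx β}

/-- No instruction is run: the final state is only reinterpreted. This is how loop counters are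
forgotten. -/
theorem imp {D' : Ctx γ} {φ : α → β} (h : Exec C D φ) (ψ : β → γ)
    (hψ : ∀ b s, D.rel b s → D'.rel (ψ b) s) : Exec C D' fun a => ψ (φ a) := by
  obtain ⟨P, p, h⟩ := h
  refine ⟨P, p, fun a s hs => ?_⟩
  obtain ⟨τ, s', r, b, v, e⟩ := h a s hs
  exact ⟨τ, s', r, b, hψ _ _ v, e⟩

/-- Address and value occupy scratch registers from `C.lvl` on, which `D` must not read; hence the
comparison of levels. -/
theorem store {f g : α → ℕ} {φ : α → β} (hf : Comp C f) (hg : Comp C g) (hl : D.lvl ≤ C.lvl)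
    (h : ∀ a s, C.rel a s → D.rel (φ a) (s.setMem (f a) (g a))) : Exec C D φ := by
  obtain ⟨P, p, hP⟩ := hf.pair hg C.lvl le_rfl
  refine ⟨.seq P (.store C.lvl (C.lvl + 1)), p + 1, fun a s hs => ?_⟩
  obtain ⟨τ, s', r, b, v, w, e⟩ := hP a s hs
  refine ⟨_, _, .seq r (.store _ _ _), by simp; omega, ?_, fun r hr => e.2 r hr⟩
  rw [v, w]
  refine D.of_agree (h a s hs) ⟨by simp [e.1], fun r hr => e.2 r (by omega)⟩

/-- Unlike in `Comp.dfold`, the body may change the memory, so the represented object itself is the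
accumulator. The counter in register `C.lvl` survives because the body preserves everything below
the level of `C.ext 0`; `hsize` makes one time bound valid for all rounds. -/
theorem loop {step : ℕ → α → α} (h : Exec (C.ext 0) C fun x => step x.2 x.1)
    (hsize : ∀ i a, C.size (step i a) = C.size a) :
    Exec C C fun a => dfold (C.size a) step a := by
  obtain ⟨Q, q, hQ⟩ := h
  set t := C.lvl with htdef
  have ht0 := C.lvl_pos
  refine ⟨.seq (.const t 0) (.seq (.add t 0 t) (.loop t
    (.seq (.const (t + 1) 1) (.seq (.sub t t (t + 1)) Q)))),
    2 + (Polynomial.X * (2 + q + 1) + 1), fun a s hs => ?_⟩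
  let s₂ := (s.setReg t 0).setReg t (C.size a)
  have r₂ : Run (.add t 0 t) (s.setReg t 0) 1 s₂ := by
    have := Run.add t 0 t (s.setReg t 0)
    have h0 : Function.update s.reg t 0 0 = C.size a := by
      rw [Function.update_of_ne (by omega), C.reg_zero hs]
    simpa [s₂, h0] using this
  let I : ℕ → State → Prop := fun i s' => s'.reg t = i ∧ (∀ r < t, s'.reg r = s.reg r) ∧
    ∃ a', C.rel a' s' ∧ C.size a' = C.size a ∧
      dfold i step a' = dfold (C.size a) step a
  obtain ⟨τ₃, s₃, r₃, b₃, -, e₃, a', ha', -, v₃⟩ := Run.exists_loop (I := I) (c := t)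
    (T := 2 + q.eval (C.size a)) (P := .seq (.const (t + 1) 1) (.seq (.sub t t (t + 1)) Q))
    (fun i s' h => h.1) (by
    rintro i s' ⟨hc, he, a', ha', hsz, hv⟩
    let s₄ := (s'.setReg (t + 1) 1).setReg t i
    have he₄ : Agree t s₄ s' := ((Agree.refl t s').setReg (by omega) _).setReg (by omega) _
    obtain ⟨τ₅, s₅, r₅, b₅, v₅, e₅⟩ := hQ (a', i) s₄
      ⟨C.of_agree ha' he₄, by simp [s₄, t]⟩
    refine ⟨1 + (1 + τ₅), s₅, .seq (.const _ _ _) (.seq (s₁ := s₄) ?_ r₅), ?_, ?_⟩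
    · have := Run.sub t t (t + 1) (s'.setReg (t + 1) 1)
      simpa [hc, s₄] using this
    · simp only [Ctx.ext, hsz] at b₅; omega
    · simp only [Ctx.ext, add_zero, ← htdef] at e₅
      refine ⟨?_, fun r hr => ?_, _, v₅, by rw [hsize, hsz], hv⟩
      · simpa [s₄] using e₅ t (by omega)
      · rw [e₅ r (by omega), he₄.2 r hr, he r hr])
    (C.size a) s₂ ⟨by simp [s₂],
      (((Agree.refl t s).setReg le_rfl _).setReg le_rfl _).2, a,
      C.of_agree hs (((Agree.refl t s).setReg le_rfl _).setReg le_rfl _), rfl, rfl⟩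
  refine ⟨_, s₃, .seq (.const _ _ _) (.seq r₂ r₃), ?_, ?_, e₃⟩
  · simp; omega
  · dsimp only; rwa [← v₃]

/-- The output of a value computed after an execution. -/
theorem outputs {φ : α → β} {f : β → ℕ} (h : Exec C D φ) (hf : Comp D f)
    (hsize : ∀ a, D.size (φ a) = C.size a) : ∃ (P : Program) (p : Polynomial ℕ), ∀ a s,
      C.rel a s → Outputs P s (p.eval (C.size a)) (f (φ a)) := by
  obtain ⟨P, p, hP⟩ := h
  obtain ⟨Q, q, hQ⟩ := hf _ le_rfl
  set t := D.lvl
  refine ⟨.seq P (.seq Q (.seq (.const (t + 1) 0) (.add 0 t (t + 1)))), p + (q + 2),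
    fun a s hs => ?_⟩
  obtain ⟨τ₁, s₁, r₁, b₁, v₁, e₁⟩ := hP a s hs
  obtain ⟨τ₂, s₂, r₂, b₂, v₂, e₂⟩ := hQ _ s₁ v₁
  refine ⟨_, _, .seq r₁ (.seq r₂ (.seq (.const _ _ _) (.add _ _ _ _))), ?_, by simp [v₂]⟩
  simp [hsize] at b₂ ⊢; omega

end Exec

end RAM

/-! ### The algorithm, and its polynomial running time -/

namespace RAM

/-- `2 ^ k`, for `k ≤ n` -/
def powTwo (n k : ℕ) : ℕ :=
  dfold n (fun i x => if i < k then x + x else x) 1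

/-- `a % 2 ^ (k + 1)`, for `k < n` and `a < 2 ^ n` -/
def lowBits (n a k : ℕ) : ℕ :=
  dfold n (fun i r => if k < i ∧ ¬ r < powTwo n i then r - powTwo n i else r) a

/-- `a ^^^ b`, for `a, b < 2 ^ n` -/
def xorVal (n a b : ℕ) : ℕ :=
  dfold n (fun k x => x + if (if lowBits n a k < powTwo n k then 0 else 1) ≠
    (if lowBits n b k < powTwo n k then 0 else 1) then powTwo n k else 0) 0

/-- `b + i * n + j`, for `i < n` -/
def address (n b i j : ℕ) : ℕ :=
  b + dfold n (fun k x => if k < i then x + n else x) j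

/-- The entry of the adjacency matrix. -/
def adjVal (n : ℕ) (m : ℕ → ℕ) (u v : ℕ) : ℕ :=
  m (address n 0 u v)

/-- The entry of the indicator vector of the labeled set. -/
def labelVal (n : ℕ) (m : ℕ → ℕ) (u : ℕ) : ℕ :=
  m (address n 0 n u)

/-- The address of the entry of the table that the programs write. -/
def tableAddr (n u v : ℕ) : ℕ :=
  address n (address n n n 0) u v

/-- The entry of the table that the programs write. -/
def tableVal (n : ℕ) (m : ℕ → ℕ) (u v : ℕ) : ℕ :=
  m (tableAddr n u v)

/-- The nim-sum of the table entries at `(v, w)`, for the neighbours `w ≠ u` of `v`. -/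
def restVal (n : ℕ) (m : ℕ → ℕ) (u v : ℕ) : ℕ :=
  dfold n (fun w x => if adjVal n m v w ≠ 0 ∧ w ≠ u then xorVal n x (tableVal n m v w) else x) 0

/-- Whether `c` is the value of an option of the branch at `(u, v)`, computed from the table. -/
def optionVal (n : ℕ) (m : ℕ → ℕ) (u v c : ℕ) : ℕ :=
  dfold n (fun w x => if (adjVal n m v w ≠ 0 ∧ w ≠ u) ∧
      xorVal n (xorVal n (restVal n m u v) (tableVal n m v w)) (restVal n m v w) = c then 1 else x)
    (if restVal n m u v = c then 1 else 0)

/-- The least value that is not the value of an option of the branch at `(u, v)`. -/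
def mexVal (n : ℕ) (m : ℕ → ℕ) (u v : ℕ) : ℕ :=
  dfold n (fun _ c => if optionVal n m u v c ≠ 0 then c + 1 else c) 0

/-- The recomputation of the table entry at `(u, v)`. -/
def update (s : State) (u v : ℕ) : State :=
  s.setMem (tableAddr (s.reg 0) u v) (mexVal (s.reg 0) s.mem u v)

/-- The recomputation of the table entries at `(u, v)` for all `v`, the context being extended by
the loop counters. -/
def updateRow (y : (State × ℕ) × ℕ) : (State × ℕ) × ℕ :=
  dfold (y.1.1.reg 0) (fun v x => ((update x.1.1 x.2 v, x.1.2), x.2)) y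

/-- The recomputation of the whole table. -/
def sweep (y : State × ℕ) : State × ℕ :=
  dfold (y.1.reg 0) (fun u x => (updateRow (x, u)).1) y

/-- The table after `n` recomputations. -/
def fill (s : State) : State :=
  dfold (s.reg 0) (fun i s => (sweep (s, i)).1) s

/-- The nim-sum of the table entries at the edges that leave the labeled set. -/
def positionVal (n : ℕ) (m : ℕ → ℕ) : ℕ :=
  dfold n (fun u x => dfold n (fun v x =>
    if (labelVal n m u ≠ 0 ∧ labelVal n m v = 0) ∧ adjVal n m u v ≠ 0
    then xorVal n x (tableVal n m u v) else x) x) 0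

/-- The nim-sum of the table entries at the edges that leave the vertex `u`. -/
def vertexVal (n : ℕ) (m : ℕ → ℕ) (u : ℕ) : ℕ :=
  dfold n (fun v x => if adjVal n m u v ≠ 0 then xorVal n x (tableVal n m u v) else x) 0

/-- Whether one of the positions with one labeled vertex has the value `0`. -/
def winVal (n : ℕ) (m : ℕ → ℕ) : ℕ :=
  dfold n (fun u x => if vertexVal n m u = 0 then 1 else x) 0

namespace Comp

variable {α : Type*} {C : Ctx α} {f g h : α → ℕ}

/-- Here and below the proof term mirrors the definition: inside a loop body `.last 0` is the
counter, `(last j).lift 0` the accumulator, and double lifts bring in values from outside the loop.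
-/
theorem powTwo (hf : Comp C f) : Comp C fun a => RAM.powTwo (C.size a) (f a) :=
  .dfold (step := fun a i x => if i < f a then x + x else x) (.const 1) fun j =>
    .ite (.lt (.last 0) ((hf.lift j).lift 0)) (.add ((last j).lift 0) ((last j).lift 0))
      ((last j).lift 0)

theorem lowBits (hf : Comp C f) (hg : Comp C g) :
    Comp C fun a => RAM.lowBits (C.size a) (f a) (g a) :=
  .dfold (step := fun a i r => if g a < i ∧ ¬ r < RAM.powTwo (C.size a) i then
      r - RAM.powTwo (C.size a) i else r) hf fun j =>
    .ite (.and (.lt ((hg.lift j).lift 0) (.last 0))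
      (.not (.lt ((last j).lift 0) (.powTwo (.last 0)))))
      (.sub ((last j).lift 0) (.powTwo (.last 0))) ((last j).lift 0)

theorem xorVal (hf : Comp C f) (hg : Comp C g) :
    Comp C fun a => RAM.xorVal (C.size a) (f a) (g a) :=
  .dfold (step := fun a k x => x + if (if RAM.lowBits (C.size a) (f a) k < RAM.powTwo (C.size a) k
      then 0 else 1) ≠ (if RAM.lowBits (C.size a) (g a) k < RAM.powTwo (C.size a) k then 0 else 1)
      then RAM.powTwo (C.size a) k else 0) (.const 0) fun j =>
    .add ((last j).lift 0) (.ite (.ne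
      (.ite (.lt (.lowBits ((hf.lift j).lift 0) (.last 0)) (.powTwo (.last 0))) (.const 0) (.const 1))
      (.ite (.lt (.lowBits ((hg.lift j).lift 0) (.last 0)) (.powTwo (.last 0))) (.const 0) (.const 1)))
      (.powTwo (.last 0)) (.const 0))

theorem address (hf : Comp C f) (hg : Comp C g) (hh : Comp C h) :
    Comp C fun a => RAM.address (C.size a) (f a) (g a) (h a) :=
  .add hf (.dfold (step := fun a k x => if k < g a then x + C.size a else x) hh fun j =>
    .ite (.lt (.last 0) ((hg.lift j).lift 0)) (.add ((last j).lift 0) (size (C := (C.ext j).ext 0)))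
      ((last j).lift 0))

theorem adjVal (hf : Comp C f) (hg : Comp C g) :
    Comp C fun a => RAM.adjVal (C.size a) (C.mem a) (f a) (g a) :=
  .load (.address (.const 0) hf hg)

theorem labelVal (hf : Comp C f) : Comp C fun a => RAM.labelVal (C.size a) (C.mem a) (f a) :=
  .load (.address (.const 0) .size hf)

theorem tableAddr (hf : Comp C f) (hg : Comp C g) :
    Comp C fun a => RAM.tableAddr (C.size a) (f a) (g a) :=
  .address (.address .size .size (.const 0)) hf hg

theorem tableVal (hf : Comp C f) (hg : Comp C g) :
    Comp C fun a => RAM.tableVal (C.size a) (C.mem a) (f a) (g a) :=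
  .load (.tableAddr hf hg)

theorem restVal (hf : Comp C f) (hg : Comp C g) :
    Comp C fun a => RAM.restVal (C.size a) (C.mem a) (f a) (g a) :=
  .dfold (step := fun a w x => if RAM.adjVal (C.size a) (C.mem a) (g a) w ≠ 0 ∧ w ≠ f a
      then RAM.xorVal (C.size a) x (RAM.tableVal (C.size a) (C.mem a) (g a) w) else x)
    (.const 0) fun j =>
    .ite (.and (.ne (adjVal (C := (C.ext j).ext 0) ((hg.lift j).lift 0) (.last 0)) (.const 0))
        (.ne (.last 0) ((hf.lift j).lift 0)))
      (xorVal (C := (C.ext j).ext 0) ((last j).lift 0)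
        (tableVal (C := (C.ext j).ext 0) ((hg.lift j).lift 0) (.last 0)))
      ((last j).lift 0)

theorem optionVal (hf : Comp C f) (hg : Comp C g) (hh : Comp C h) :
    Comp C fun a => RAM.optionVal (C.size a) (C.mem a) (f a) (g a) (h a) :=
  .dfold (step := fun a w x => if (RAM.adjVal (C.size a) (C.mem a) (g a) w ≠ 0 ∧ w ≠ f a) ∧
      RAM.xorVal (C.size a) (RAM.xorVal (C.size a) (RAM.restVal (C.size a) (C.mem a) (f a) (g a))
        (RAM.tableVal (C.size a) (C.mem a) (g a) w))
        (RAM.restVal (C.size a) (C.mem a) (g a) w) = h a then 1 else x)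
    (.ite (.eq (.restVal hf hg) hh) (.const 1) (.const 0)) fun j =>
    have hf' := (hf.lift j).lift 0
    have hg' := (hg.lift j).lift 0
    .ite (.and (.and (.ne (adjVal (C := (C.ext j).ext 0) hg' (.last 0)) (.const 0))
        (.ne (.last 0) hf'))
        (.eq (xorVal (C := (C.ext j).ext 0) (xorVal (C := (C.ext j).ext 0)
          (restVal (C := (C.ext j).ext 0) hf' hg') (tableVal (C := (C.ext j).ext 0) hg' (.last 0)))
          (restVal (C := (C.ext j).ext 0) hg' (.last 0))) ((hh.lift j).lift 0)))
      (.const 1) ((last j).lift 0)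

theorem mexVal (hf : Comp C f) (hg : Comp C g) :
    Comp C fun a => RAM.mexVal (C.size a) (C.mem a) (f a) (g a) :=
  .dfold (step := fun a _ c => if RAM.optionVal (C.size a) (C.mem a) (f a) (g a) c ≠ 0
      then c + 1 else c) (.const 0) fun j =>
    .ite (.ne (optionVal (C := (C.ext j).ext 0) ((hf.lift j).lift 0) ((hg.lift j).lift 0)
        ((last j).lift 0)) (.const 0))
      (.add ((last j).lift 0) (.const 1)) ((last j).lift 0)

theorem positionVal : Comp C fun a => RAM.positionVal (C.size a) (C.mem a) :=
  .dfold (step := fun a u x => RAM.dfold (C.size a) (fun v x =>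
      if (RAM.labelVal (C.size a) (C.mem a) u ≠ 0 ∧ RAM.labelVal (C.size a) (C.mem a) v = 0) ∧
        RAM.adjVal (C.size a) (C.mem a) u v ≠ 0
      then RAM.xorVal (C.size a) x (RAM.tableVal (C.size a) (C.mem a) u v) else x) x)
    (.const 0) fun j =>
    -- The inner loop starts from the outer accumulator, so each level carries a single number.
    .dfold (C := (C.ext j).ext 0) (step := fun b v x =>
      if (RAM.labelVal (C.size b.1.1) (C.mem b.1.1) b.2 ≠ 0 ∧
        RAM.labelVal (C.size b.1.1) (C.mem b.1.1) v = 0) ∧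
        RAM.adjVal (C.size b.1.1) (C.mem b.1.1) b.2 v ≠ 0
      then RAM.xorVal (C.size b.1.1) x (RAM.tableVal (C.size b.1.1) (C.mem b.1.1) b.2 v) else x)
      ((last j).lift 0) fun i =>
    have hu := ((last (C := C.ext j) 0).lift i).lift 0
    have hv := last (C := ((C.ext j).ext 0).ext i) 0
    have hx := (last (C := (C.ext j).ext 0) i).lift 0
    .ite (.and (.and (.ne (labelVal (C := (((C.ext j).ext 0).ext i).ext 0) hu) (.const 0))
        (.eq (labelVal (C := (((C.ext j).ext 0).ext i).ext 0) hv) (.const 0)))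
        (.ne (adjVal (C := (((C.ext j).ext 0).ext i).ext 0) hu hv) (.const 0)))
      (xorVal (C := (((C.ext j).ext 0).ext i).ext 0) hx
        (tableVal (C := (((C.ext j).ext 0).ext i).ext 0) hu hv)) hx

theorem vertexVal (hf : Comp C f) :
    Comp C fun a => RAM.vertexVal (C.size a) (C.mem a) (f a) :=
  .dfold (step := fun a v x => if RAM.adjVal (C.size a) (C.mem a) (f a) v ≠ 0
      then RAM.xorVal (C.size a) x (RAM.tableVal (C.size a) (C.mem a) (f a) v) else x)
    (.const 0) fun j =>
    .ite (.ne (adjVal (C := (C.ext j).ext 0) ((hf.lift j).lift 0) (.last 0)) (.const 0))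
      (xorVal (C := (C.ext j).ext 0) ((last j).lift 0)
        (tableVal (C := (C.ext j).ext 0) ((hf.lift j).lift 0) (.last 0)))
      ((last j).lift 0)

theorem winVal : Comp C fun a => RAM.winVal (C.size a) (C.mem a) :=
  .dfold (step := fun a u x => if RAM.vertexVal (C.size a) (C.mem a) u = 0 then 1 else x)
    (.const 0) fun j =>
    .ite (.eq (vertexVal (C := (C.ext j).ext 0) (.last 0)) (.const 0)) (.const 1) ((last j).lift 0)

end Comp

theorem reg_updateRow (y : (State × ℕ) × ℕ) : (updateRow y).1.1.reg = y.1.1.reg :=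
  dfold_induction (fun _ (x : (State × ℕ) × ℕ) => x.1.1.reg = y.1.1.reg) rfl fun _ _ _ h => h

theorem reg_sweep (y : State × ℕ) : (sweep y).1.reg = y.1.reg :=
  dfold_induction (fun _ (x : State × ℕ) => x.1.reg = y.1.reg) rfl fun _ _ _ h =>
    (reg_updateRow _).trans h

theorem reg_fill (s : State) : (fill s).reg = s.reg :=
  dfold_induction (fun _ (x : State) => x.reg = s.reg) rfl fun _ _ _ h => (reg_sweep _).trans h

theorem Exec.updateRow :
    Exec ((Ctx.base.ext 0).ext 0) ((Ctx.base.ext 0).ext 0) updateRow := by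
  refine .loop (C := (Ctx.base.ext 0).ext 0)
    (step := fun v x => ((update x.1.1 x.2 v, x.1.2), x.2)) ?_ fun _ _ => rfl
  refine .store (C := ((Ctx.base.ext 0).ext 0).ext 0)
    (Comp.tableAddr (C := ((Ctx.base.ext 0).ext 0).ext 0) ((Comp.last 0).lift 0) (Comp.last 0))
    (Comp.mexVal (C := ((Ctx.base.ext 0).ext 0).ext 0) ((Comp.last 0).lift 0) (Comp.last 0))
    (by simp [Ctx.ext]) ?_
  rintro ⟨⟨⟨a, i⟩, u⟩, v⟩ s ⟨⟨⟨h₁, h₂⟩, h₃⟩, h₄⟩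
  exact ⟨⟨⟨congrArg (Function.update · _ _) h₁.1, h₁.2⟩, h₂⟩, h₃⟩

theorem Exec.sweep : Exec (Ctx.base.ext 0) (Ctx.base.ext 0) sweep :=
  .loop (C := Ctx.base.ext 0) (step := fun u x => (RAM.updateRow (x, u)).1)
    (Exec.updateRow.imp Prod.fst fun _ _ h => h.1) fun _ _ => congrFun (reg_updateRow _) 0

theorem Exec.fill : Exec Ctx.base Ctx.base fill :=
  .loop (C := Ctx.base) (step := fun i s => (RAM.sweep (s, i)).1)
    (Exec.sweep.imp Prod.fst fun _ _ h => h.1) fun _ _ => congrFun (reg_sweep _) 0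

/-- A value computed from the filled table is the output of a polynomial-time program. -/
theorem exists_program {f : State → ℕ} (hf : Comp Ctx.base f) :
    ∃ (P : Program) (p : Polynomial ℕ), ∀ s, Outputs P s (p.eval (s.reg 0)) (f (fill s)) := by
  obtain ⟨P, p, h⟩ := Exec.fill.outputs hf fun _ => congrFun (reg_fill _) 0
  exact ⟨P, p, fun s => h s s (Agree.refl 1 s)⟩

end RAM

/-! ### Edges, sides and moves in a tree -/

namespace P3Game

section Tree

variable {V : Type*} {G : SimpleGraph V}

theorem exists_adj_dist_add_one (hG : G.Connected) {x v : V} (h : x ≠ v) :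
    ∃ y, G.Adj x y ∧ G.dist y v + 1 = G.dist x v := by
  obtain ⟨p, hp⟩ := hG.exists_walk_length_eq_dist x v
  cases p with
  | nil => exact absurd rfl h
  | cons hxy q =>
    refine ⟨_, hxy, ?_⟩
    have h₁ := SimpleGraph.dist_le q
    have h₂ := hxy.diff_dist_adj (u := v)
    simp only [SimpleGraph.Walk.length_cons] at hp
    simp only [SimpleGraph.dist_comm (u := v)] at h₂
    omega

/-- In a tree rooted at `x` a vertex has only one parent: geodesics to both candidates extend to
paths to `v`, which coincide, and so do their penultimate vertices. -/
theorem eq_of_adj_of_dist_lt (hG : G.IsTree) {x u v w : V} (hu : G.Adj u v) (hw : G.Adj w v)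
    (hxu : G.dist x u < G.dist x v) (hxw : G.dist x w < G.dist x v) : u = w := by
  have key : ∀ {y}, (hy : G.Adj y v) → G.dist x y < G.dist x v →
      ∃ p : G.Walk x v, p.IsPath ∧ p.penultimate = y := by
    intro y hy hlt
    obtain ⟨p, hp⟩ := hG.connected.exists_walk_length_eq_dist x y
    refine ⟨p.concat hy, SimpleGraph.Walk.isPath_of_length_eq_dist _ ?_, by simp⟩
    have h₁ := SimpleGraph.dist_le (p.concat hy)
    simp only [SimpleGraph.Walk.length_concat] at h₁ ⊢
    omega
  obtain ⟨p, hp, rfl⟩ := key hu hxu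
  obtain ⟨q, hq, rfl⟩ := key hw hxw
  rw [(hG.existsUnique_path x v).unique hp hq]

/-- The vertices on the side of `v` of the edge `uv`. -/
def side (G : SimpleGraph V) (u v : V) : Set V :=
  {x | G.dist x v < G.dist x u}

theorem notMem_side_left (u v : V) : u ∉ side G u v := by simp [side]

theorem mem_side_right {u v : V} (h : G.Adj u v) : v ∈ side G u v := by
  simp [side, SimpleGraph.dist_eq_one_iff_adj.mpr h.symm]

/-- An edge between the two sides of `uv` is `uv`. -/
theorem eq_of_adj_of_mem_side (hG : G.IsTree) {u v y z : V} (huv : G.Adj u v) (hyz : G.Adj y z)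
    (hz : z ∈ side G u v) (hy : y ∉ side G u v) : y = u ∧ z = v := by
  simp only [side, Set.mem_ofPred_eq, not_lt] at hy hz
  have h₁ := hG.dist_eq_dist_add_one_of_adj z huv
  have h₂ := hG.dist_eq_dist_add_one_of_adj y huv
  have h₃ := hG.dist_eq_dist_add_one_of_adj u hyz
  have h₄ := hG.dist_eq_dist_add_one_of_adj v hyz
  simp only [SimpleGraph.dist_comm (v := y), SimpleGraph.dist_comm (v := z)] at *
  -- Otherwise `z` has a neighbour `z'` closer to `v`. Rooted at `u`, both `y` and `z'` are parents
  -- of `z`, so `y = z'`, which lies on the wrong side.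
  have hzv : z = v := by
    by_contra hne
    obtain ⟨z', hz', hd⟩ := exists_adj_dist_add_one hG.connected hne
    have h₅ := hG.connected.dist_triangle (u := z') (v := v) (w := u)
    have h₆ := SimpleGraph.dist_eq_one_iff_adj.mpr huv.symm
    have := eq_of_adj_of_dist_lt hG (x := u) hyz hz'.symm
      (by simp only [SimpleGraph.dist_comm (u := u)]; omega)
      (by simp only [SimpleGraph.dist_comm (u := u)]; omega)
    subst this
    omega
  refine ⟨?_, hzv⟩
  subst hzv
  rw [SimpleGraph.dist_self] at *
  exact (hG.connected y u).dist_eq_zero_iff.mp (by omega)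

/-- The sides of the edges that leave `v` are properly contained in that of an edge that
enters `v`. -/
theorem side_ssubset (hG : G.IsTree) {u v w : V} (huv : G.Adj u v) (hvw : G.Adj v w)
    (hwu : w ≠ u) : side G v w ⊂ side G u v := by
  refine ⟨fun x hx => ?_, fun h => notMem_side_left v w (h (mem_side_right huv))⟩
  simp only [side, Set.mem_ofPred_eq] at hx ⊢
  by_contra hlt
  have := hG.dist_eq_dist_add_one_of_adj x huv
  -- Rooted at `x`, the vertex `v` would have the two parents `w` and `u`.
  exact hwu (eq_of_adj_of_dist_lt hG hvw.symm huv hx (by omega))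

/-- A walk inside `S` from `D` to its complement crosses the boundary of `D`. Combined with
`eq_of_adj_of_mem_side`, it forces connected sets through a given edge. -/
theorem exists_adj_of_preconnected {S D : Set V} (hS : (G.induce S).Preconnected) {x y : V}
    (hx : x ∈ S) (hy : y ∈ S) (hxD : x ∈ D) (hyD : y ∉ D) :
    ∃ a ∈ S, ∃ b ∈ S, G.Adj a b ∧ a ∈ D ∧ b ∉ D := by
  obtain ⟨p⟩ := hS ⟨x, hx⟩ ⟨y, hy⟩
  obtain ⟨d, -, h₁, h₂⟩ := p.exists_boundary_dart {z | z.1 ∈ D} hxD hyD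
  exact ⟨_, d.fst.2, _, d.snd.2, d.adj, h₁, h₂⟩

/-- If `v ∉ S` had two neighbours `y ≠ z` in `S`, they would be separated by the edge `vy`, and a
connection within `S` would pass through `v`. -/
theorem isP3Closed_of_preconnected (hG : G.IsTree) {S : Set V}
    (hS : (G.induce S).Preconnected) : IsP3Closed G S := by
  intro v hv
  rw [← not_le, show (2 : ℕ∞) = 1 + 1 by norm_num,
    ENat.add_one_le_iff (by simp), not_lt, Set.encard_le_one_iff]
  rintro y z ⟨hy, hyS⟩ ⟨hz, hzS⟩
  by_contra hne
  have hzD : z ∉ side G v y := fun h =>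
    hne (eq_of_adj_of_dist_lt hG hy.symm (SimpleGraph.Adj.symm hz) (x := z) h
      (by simp [SimpleGraph.dist_eq_one_iff_adj.mpr (SimpleGraph.Adj.symm hz)]))
  obtain ⟨a, haS, b, hbS, hab, ha, hb⟩ :=
    exists_adj_of_preconnected hS hyS hzS (mem_side_right hy) hzD
  exact hv ((eq_of_adj_of_mem_side hG hy hab.symm ha hb).1 ▸ hbS)

theorem IsP3Closed.eq_of_adj {L : Set V} (hL : IsP3Closed G L) {v y z : V} (hv : v ∉ L)
    (hy : y ∈ L) (hz : z ∈ L) (hvy : G.Adj v y) (hvz : G.Adj v z) : y = z := by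
  have := hL v hv
  rw [← not_le, show (2 : ℕ∞) = 1 + 1 by norm_num,
    ENat.add_one_le_iff (by simp), not_lt, Set.encard_le_one_iff] at this
  exact this y z ⟨hvy, hy⟩ ⟨hvz, hz⟩

theorem preconnected_insert {S : Set V} (hS : (G.induce S).Preconnected) {u v : V} (hu : u ∈ S)
    (huv : G.Adj u v) : (G.induce (insert v S)).Preconnected := by
  have hsub : S ⊆ insert v S := Set.subset_insert v S
  have key : ∀ x : (insert v S : Set V),
      (G.induce (insert v S)).Reachable x ⟨u, hsub hu⟩ := by
    rintro ⟨x, rfl | hx⟩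
    · exact SimpleGraph.Adj.reachable (G := G.induce _) huv.symm
    · exact (hS ⟨x, hx⟩ ⟨u, hu⟩).map (G.induceHomOfLE hsub).toHom
  exact fun x y => (key x).trans (key y).symm

theorem hull_subset {A K : Set V} (hK : IsP3Closed G K) (h : A ⊆ K) : hull G A ⊆ K :=
  fun _ hx => hx K ⟨hK, h⟩

theorem isPosition_insert (hG : G.IsTree) {L : Set V} (hL : IsPosition G L) {u v : V} (hu : u ∈ L)
    (huv : G.Adj u v) : IsPosition G (insert v L) :=
  have h := preconnected_insert hL.2 hu huv
  ⟨isP3Closed_of_preconnected hG h, h⟩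

theorem move_of_adj (hG : G.IsTree) {L : Set V} (hL : IsPosition G L) {u v : V} (hu : u ∈ L)
    (huv : G.Adj u v) : move G L v = insert v L :=
  (hull_subset (isPosition_insert hG hL hu huv).1 subset_rfl).antisymm (subset_hull G _)

/-- The middle vertex `v` has the two labeled neighbours `u` and `w`, so it lies in every closed set
containing them; nothing else is forced, since the enlarged set is connected and hence closed. -/
theorem move_of_adj_of_adj (hG : G.IsTree) {L : Set V} (hL : IsPosition G L) {u v w : V}
    (hu : u ∈ L) (huv : G.Adj u v) (hvw : G.Adj v w) (hwu : w ≠ u) :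
    move G L w = insert w (insert v L) := by
  have hL' := isPosition_insert hG hL hu huv
  refine (hull_subset (isPosition_insert hG hL' (Set.mem_insert v L) hvw).1
    (Set.insert_subset_insert (Set.subset_insert v L))).antisymm ?_
  refine Set.insert_subset (subset_hull G _ (Set.mem_insert w L)) (Set.insert_subset ?_
    ((Set.subset_insert w L).trans (subset_hull G _)))
  rintro K ⟨hK, hLK⟩
  by_contra hv
  exact hwu (hK.eq_of_adj hv (hLK (Set.mem_insert w L)) (hLK (Set.mem_insert_of_mem w hu)) hvw
    huv.symm)

/-- In a nonempty position, a move selects a vertex at distance one or two. -/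
theorem IsLegal.exists_adj {L : Set V} (hL : IsPosition G L) (hne : L.Nonempty) {x : V}
    (h : IsLegal G L x) :
    ∃ u ∈ L, ∃ v, v ∉ L ∧ G.Adj u v ∧ (x = v ∨ G.Adj v x ∧ x ≠ u) := by
  obtain ⟨hx, hconn⟩ := h
  by_contra! hno
  have hadj : ∀ u ∈ L, ¬ G.Adj u x := fun u hu hux => (hno u hu x hx hux).1 rfl
  -- A vertex with two neighbours in `insert x L` would have both in the closed set `L`, or else
  -- link `x` to `L` by a path of length two. So a more distant `x` adds only itself, and the new
  -- set is disconnected.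
  have hclosed : IsP3Closed G (insert x L) := by
    intro v hv
    simp only [Set.mem_insert_iff, not_or] at hv
    rw [← not_le, show (2 : ℕ∞) = 1 + 1 by norm_num,
      ENat.add_one_le_iff (by simp), not_lt, Set.encard_le_one_iff]
    have hmid : G.Adj v x → ∀ z ∈ L, ¬ G.Adj v z := fun hvx z hz hvz =>
      hx ((hno z hz v hv.2 hvz.symm).2 hvx ▸ hz)
    rintro y z ⟨hy, rfl | hyL⟩ ⟨hz, rfl | hzL⟩
    · rfl
    · exact absurd hz (hmid hy z hzL)
    · exact absurd hy (hmid hz y hyL)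
    · exact hL.1.eq_of_adj hv.2 hyL hzL hy hz
  have hmove : move G L x = insert x L :=
    (hull_subset hclosed subset_rfl).antisymm (subset_hull G _)
  rw [hmove] at hconn
  obtain ⟨u, hu⟩ := hne
  obtain ⟨a, ha, b, hb, hab, haL, hbL⟩ := exists_adj_of_preconnected (D := L) hconn.preconnected
    (Set.mem_insert_of_mem x hu) (Set.mem_insert x L) hu hx
  exact hadj a haL (((Set.mem_insert_iff.mp hb).resolve_right hbL) ▸ hab)

end Tree

/-! ### Nim-sums and minimal excludants -/

section Nim

variable {ι κ : Type*}

theorem nimSum_empty (f : ι → ℕ) : nimSum ∅ f = 0 := rfl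

theorem nimSum_insert [DecidableEq ι] {s : Finset ι} {i : ι} (hi : i ∉ s) (f : ι → ℕ) :
    nimSum (insert i s) f = f i ^^^ nimSum s f :=
  Finset.fold_insert hi

theorem nimSum_congr {s : Finset ι} {f g : ι → ℕ} (h : ∀ i ∈ s, f i = g i) :
    nimSum s f = nimSum s g :=
  Finset.fold_congr h

theorem nimSum_union [DecidableEq ι] {s t : Finset ι} (h : Disjoint s t) (f : ι → ℕ) :
    nimSum (s ∪ t) f = nimSum s f ^^^ nimSum t f := by
  have := Finset.fold_union_inter (op := fun a b : ℕ => a ^^^ b) (f := f) (s₁ := s) (s₂ := t)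
    (b₁ := 0) (b₂ := 0)
  rw [Finset.disjoint_iff_inter_eq_empty.mp h] at this
  simpa [nimSum] using this

theorem nimSum_image [DecidableEq ι] {s : Finset κ} {g : κ → ι}
    (hg : Set.InjOn g s) (f : ι → ℕ) : nimSum (s.image g) f = nimSum s fun k => f (g k) :=
  Finset.fold_image hg

theorem nimSum_erase [DecidableEq ι] {s : Finset ι} {i : ι} (hi : i ∈ s) (f : ι → ℕ) :
    nimSum (s.erase i) f = f i ^^^ nimSum s f := by
  conv_rhs => rw [← Finset.insert_erase hi, nimSum_insert (Finset.notMem_erase i s)]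
  rw [← Nat.xor_assoc, Nat.xor_self, Nat.zero_xor]

/-- The winning move in nim: a total below the nim-sum is reached by lowering one heap.
`Nat.lt_xor_cases` decides whether that heap is the inserted one or among the rest. -/
theorem exists_xor_lt_of_lt_nimSum {s : Finset ι} {f : ι → ℕ} {y : ℕ} (h : y < nimSum s f) :
    ∃ i ∈ s, y ^^^ nimSum s f ^^^ f i < f i := by
  classical
  induction s using Finset.induction_on generalizing y with
  | empty => exact absurd h (Nat.not_lt_zero y)
  | insert i s hi ih =>
    rw [nimSum_insert hi] at h ⊢
    rcases Nat.lt_xor_cases h with h | h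
    · refine ⟨i, Finset.mem_insert_self i s, ?_⟩
      have : y ^^^ (f i ^^^ nimSum s f) ^^^ f i = y ^^^ nimSum s f := by
        rw [Nat.xor_comm (f i), ← Nat.xor_assoc, Nat.xor_assoc, Nat.xor_self, Nat.xor_zero]
      rwa [this]
    · obtain ⟨j, hj, hlt⟩ := ih h
      exact ⟨j, Finset.mem_insert_of_mem hj, by rwa [← Nat.xor_assoc y]⟩

/-- The least natural number that is not in a finite set. -/
noncomputable def mex (s : Finset ℕ) : ℕ :=
  sInf {c | c ∉ s}

theorem mex_notMem (s : Finset ℕ) : mex s ∉ s :=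
  Nat.sInf_mem (s := {c | c ∉ s}) (Infinite.exists_notMem_finset s)

theorem mem_of_lt_mex {s : Finset ℕ} {c : ℕ} (h : c < mex s) : c ∈ s :=
  not_not.mp (Nat.notMem_of_lt_sInf h)

/-- Everything below the mex lies in `s`. This bounds the table entries and the number of rounds of
the mex search. -/
theorem mex_le_card (s : Finset ℕ) : mex s ≤ s.card := by
  simpa using Finset.card_le_card (s := Finset.range (mex s)) (t := s)
    fun c hc => mem_of_lt_mex (Finset.mem_range.mp hc)

end Nim

/-! ### Grundy values and winning strategies -/

section Grundy

variable {V : Type*} [Finite V] {G : SimpleGraph V}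

theorem grundy_move_ne {L : Set V} {x : V} (h : IsLegal G L x) :
    grundy G (move G L x) ≠ grundy G L := by
  -- The infimum is attained only for a nonempty set; there are finitely many moves, so some number
  -- is missed.
  have hne : {n | ∀ x, (h : IsLegal G L x) → grundy G (move G L x) ≠ n}.Nonempty := by
    obtain ⟨n, hn⟩ := Infinite.exists_notMem_finset
      (Set.toFinite (Set.range fun x => grundy G (move G L x))).toFinset
    exact ⟨n, fun x _ hx => hn (by simp [← hx])⟩
  rw [grundy.eq_def G L]
  exact Nat.sInf_mem hne x h

theorem exists_grundy_move_eq {L : Set V} {m : ℕ} (h : m < grundy G L) :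
    ∃ x, IsLegal G L x ∧ grundy G (move G L x) = m := by
  rw [grundy.eq_def] at h
  have := Nat.notMem_of_lt_sInf h
  simpa using this

theorem grundy_eq_of {L : Set V} {g : ℕ} (h : ∀ x, IsLegal G L x → grundy G (move G L x) ≠ g)
    (h' : ∀ m < g, ∃ x, IsLegal G L x ∧ grundy G (move G L x) = m) : grundy G L = g := by
  rcases lt_trichotomy (grundy G L) g with hlt | heq | hgt
  · obtain ⟨x, hx, hxm⟩ := h' _ hlt
    exact absurd hxm (grundy_move_ne hx)
  · exact heq
  · obtain ⟨x, hx, hxm⟩ := exists_grundy_move_eq hgt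
    exact absurd hxm (h x hx)

/-- The winning strategy always moves to value `0`. Conversely, from value `0` every move leads to a
nonzero value, and the opponent can return to `0`, which by induction is not winning. -/
theorem exists_winsWith_iff (L : Set V) : (∃ s, WinsWith G s L) ↔ grundy G L ≠ 0 := by
  classical
  constructor
  · rintro ⟨s, hs⟩
    induction hs with
    | intro L legal answer ih =>
      intro h0
      obtain ⟨y, hy, hy0⟩ := exists_grundy_move_eq
        (Nat.pos_of_ne_zero fun h => grundy_move_ne legal (h.trans h0.symm))
      exact ih y hy hy0
  · intro h0
    rcases isEmpty_or_nonempty V with hV | hV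
    · obtain ⟨x, -⟩ := exists_grundy_move_eq (Nat.pos_of_ne_zero h0)
      exact hV.elim x
    -- At positions of value `0` the strategy takes an arbitrary vertex; it never meets them when it
    -- is its turn.
    have key : ∀ L : Set V, ∃ x, grundy G L ≠ 0 → IsLegal G L x ∧ grundy G (move G L x) = 0 := by
      intro L
      by_cases h : grundy G L = 0
      · exact ⟨hV.some, fun h' => absurd h h'⟩
      · obtain ⟨x, hx⟩ := exists_grundy_move_eq (Nat.pos_of_ne_zero h)
        exact ⟨x, fun _ => hx⟩
    choose s hs using key
    refine ⟨s, ?_⟩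
    induction hn : Lᶜ.ncard using Nat.strong_induction_on generalizing L with
    | _ n ih =>
      subst hn
      obtain ⟨h₁, h₂⟩ := hs L h0
      refine .intro L h₁ fun y hy => ih _ (hy.ncard_compl_lt.trans h₁.ncard_compl_lt) _ ?_ rfl
      rw [← h₂]
      exact grundy_move_ne hy

/-- From the empty position every vertex may be selected and labels only itself. -/
theorem firstPlayerWins_iff (hG : G.IsTree) : FirstPlayerWins G ↔ ∃ x, grundy G {x} = 0 := by
  have hmove : ∀ x, move G ∅ x = {x} ∧ IsLegal G ∅ x := by
    intro x
    have hpre : (G.induce {x}).Connected :=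
      { preconnected := fun a b => by rw [Subsingleton.elim a b]
        nonempty := ⟨x, rfl⟩ }
    have : move G ∅ x = {x} := by
      rw [move, LawfulSingleton.insert_empty_eq]
      exact (hull_subset (isP3Closed_of_preconnected hG hpre.preconnected)
        subset_rfl).antisymm (subset_hull G _)
    exact ⟨this, Set.notMem_empty x, this.symm ▸ hpre⟩
  rw [FirstPlayerWins, exists_winsWith_iff]
  constructor
  · intro h
    obtain ⟨x, hx, h0⟩ := exists_grundy_move_eq (Nat.pos_of_ne_zero h)
    exact ⟨x, (hmove x).1 ▸ h0⟩
  · rintro ⟨x, hx⟩ h0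
    exact grundy_move_ne (hmove x).2 (by rw [(hmove x).1, hx, h0])

end Grundy

end P3Game

/-! ### The Sprague–Grundy recursion along boundary edges -/

namespace P3Game

section Boundary

variable {V : Type*} [Finite V] {G : SimpleGraph V}

/-- The edges that leave `L`, directed outwards. -/
noncomputable def boundary (G : SimpleGraph V) (L : Set V) : Finset (V × V) :=
  (Set.toFinite {e : V × V | e.1 ∈ L ∧ e.2 ∉ L ∧ G.Adj e.1 e.2}).toFinset

@[simp] theorem mem_boundary {L : Set V} {e : V × V} :
    e ∈ boundary G L ↔ e.1 ∈ L ∧ e.2 ∉ L ∧ G.Adj e.1 e.2 := by simp [boundary]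

/-- The neighbours of `v` other than `u`. -/
noncomputable def children (G : SimpleGraph V) (u v : V) : Finset V :=
  (Set.toFinite {w | G.Adj v w ∧ w ≠ u}).toFinset

@[simp] theorem mem_children {u v w : V} : w ∈ children G u v ↔ G.Adj v w ∧ w ≠ u := by
  simp [children]

/-- The value, according to `F`, of the branch at the edge `uv` after `v` has been labeled. -/
noncomputable def rest (G : SimpleGraph V) (F : V → V → ℕ) (u v : V) : ℕ :=
  nimSum (children G u v) (F v)

open Classical in
/-- The values, according to `F`, of the options of the branch at the edge `uv`. -/
noncomputable def options (G : SimpleGraph V) (F : V → V → ℕ) (u v : V) : Finset ℕ :=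
  insert (rest G F u v)
    ((children G u v).image fun w => rest G F u v ^^^ F v w ^^^ rest G F v w)

theorem rest_congr {F F' : V → V → ℕ} {u v : V} (h : ∀ w ∈ children G u v, F v w = F' v w) :
    rest G F u v = rest G F' u v :=
  nimSum_congr h

theorem options_congr {F F' : V → V → ℕ} {u v : V} (h : ∀ w ∈ children G u v, F v w = F' v w)
    (h' : ∀ w ∈ children G u v, ∀ x ∈ children G v w, F w x = F' w x) :
    options G F u v = options G F' u v := by
  unfold options
  rw [rest_congr h]
  congr 1
  refine Finset.image_congr fun w hw => ?_
  simp only [h w hw, rest_congr (h' w hw)]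

/-- The vertex `u` is not a child, so there are fewer children than vertices, and the option of
labeling `v` alone adds one. -/
theorem card_options_le [Fintype V] (G : SimpleGraph V) (F : V → V → ℕ) (u v : V) :
    (options G F u v).card ≤ Fintype.card V := by
  classical
  have h₁ : (children G u v).card < Fintype.card V :=
    Finset.card_lt_univ_of_notMem (x := u) (by simp)
  exact (Finset.card_insert_le _ _).trans ((Nat.succ_le_succ Finset.card_image_le).trans h₁)

/-- The edge `uv` is replaced by the edges from `v` to its children. Closedness of `L` makes `u` the
only labeled neighbour of `v`: no other boundary edge is lost and no child is labeled already. The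
nim-sum with `F u v` cancels the old edge. -/
theorem nimSum_boundary_insert {L : Set V} (hL : IsPosition G L) (F : V → V → ℕ) {u v : V}
    (hu : u ∈ L) (hv : v ∉ L) (huv : G.Adj u v) :
    nimSum (boundary G (insert v L)) (fun e => F e.1 e.2) =
      nimSum (boundary G L) (fun e => F e.1 e.2) ^^^ F u v ^^^ rest G F u v := by
  classical
  have hset : boundary G (insert v L) =
      (boundary G L).erase (u, v) ∪ (children G u v).image (Prod.mk v) := by
    ext ⟨a, b⟩
    simp only [mem_boundary, Finset.mem_union, Finset.mem_erase, Finset.mem_image, mem_children,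
      Set.mem_insert_iff, not_or, Prod.mk.injEq, ne_eq]
    constructor
    · rintro ⟨rfl | ha, ⟨hb, hbL⟩, hab⟩
      · exact .inr ⟨b, ⟨hab, fun h => hbL (h ▸ hu)⟩, rfl, rfl⟩
      · exact .inl ⟨fun h => hb h.2, ha, hbL, hab⟩
    · rintro (⟨hne, ha, hb, hab⟩ | ⟨w, ⟨hw, hwu⟩, rfl, rfl⟩)
      · refine ⟨.inr ha, ⟨?_, hb⟩, hab⟩
        rintro rfl
        exact hne ⟨hL.1.eq_of_adj hv ha hu hab.symm huv.symm, rfl⟩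
      · exact ⟨.inl rfl, ⟨hw.ne', fun h => hwu (hL.1.eq_of_adj hv h hu hw huv.symm)⟩, hw⟩
  have hdisj : Disjoint ((boundary G L).erase (u, v)) ((children G u v).image (Prod.mk v)) := by
    rw [Finset.disjoint_left]
    rintro ⟨a, b⟩ h h'
    simp only [mem_boundary, Finset.mem_erase, Finset.mem_image, Prod.mk.injEq] at h h'
    obtain ⟨w, -, rfl, -⟩ := h'
    exact hv h.2.1
  rw [hset, nimSum_union hdisj, nimSum_image (Prod.mk_right_injective v).injOn,
    nimSum_erase (mem_boundary.mpr ⟨hu, hv, huv⟩), rest, Nat.xor_comm (F u v)]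

/-- If `F` satisfies the recursion of the Grundy values of branches at all edges that can be
reached from the position `L₀`, then it yields the Grundy values. -/
theorem grundy_eq_nimSum_boundary (hG : G.IsTree) {L₀ : Set V} (F : V → V → ℕ)
    (hF : ∀ L, IsPosition G L → L₀ ⊆ L → ∀ u ∈ L, ∀ v, v ∉ L → G.Adj u v →
      F u v = mex (options G F u v)) {L : Set V} (hL : IsPosition G L) (hne : L.Nonempty)
    (hsub : L₀ ⊆ L) : grundy G L = nimSum (boundary G L) fun e => F e.1 e.2 := by
  induction hn : Lᶜ.ncard using Nat.strong_induction_on generalizing L with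
  | _ n ih =>
  subst hn
  have hval : ∀ u ∈ L, ∀ v, v ∉ L → G.Adj u v → IsLegal G L v ∧
      grundy G (move G L v) =
        nimSum (boundary G L) (fun e => F e.1 e.2) ^^^ F u v ^^^ rest G F u v := by
    intro u hu v hv huv
    have hpos := isPosition_insert hG hL hu huv
    have hmove := move_of_adj hG hL hu huv
    have hleg : IsLegal G L v :=
      ⟨hv, hmove.symm ▸ { preconnected := hpos.2, nonempty := ⟨v, Set.mem_insert v L⟩ }⟩
    refine ⟨hleg, ?_⟩
    have hlt := hleg.ncard_compl_lt
    rw [hmove] at hlt ⊢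
    rw [ih _ hlt hpos ⟨v, Set.mem_insert v L⟩ (hsub.trans (Set.subset_insert v L)) rfl,
      nimSum_boundary_insert hL F hu hv huv]
  -- Selecting `w` has the effect of labeling first `v`, then `w`.
  have hval' : ∀ u ∈ L, ∀ v, v ∉ L → G.Adj u v → ∀ w ∈ children G u v, IsLegal G L w ∧
      grundy G (move G L w) = nimSum (boundary G L) (fun e => F e.1 e.2) ^^^ F u v ^^^
        (rest G F u v ^^^ F v w ^^^ rest G F v w) := by
    intro u hu v hv huv w hw
    rw [mem_children] at hw
    have hpos := isPosition_insert hG hL hu huv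
    have hpos' := isPosition_insert hG hpos (Set.mem_insert v L) hw.1
    have hmove := move_of_adj_of_adj hG hL hu huv hw.1 hw.2
    have hwL : w ∉ L := fun h => hw.2 (hL.1.eq_of_adj hv h hu hw.1 huv.symm)
    have hleg : IsLegal G L w :=
      ⟨hwL, hmove.symm ▸ { preconnected := hpos'.2, nonempty := ⟨w, Set.mem_insert w _⟩ }⟩
    refine ⟨hleg, ?_⟩
    have hlt := hleg.ncard_compl_lt
    rw [hmove] at hlt ⊢
    rw [ih _ hlt hpos' ⟨w, Set.mem_insert w _⟩ (hsub.trans ((Set.subset_insert v L).trans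
        (Set.subset_insert w _))) rfl,
      nimSum_boundary_insert hpos F (Set.mem_insert v L)
        (by simpa [hwL] using hw.1.ne') hw.1,
      nimSum_boundary_insert hL F hu hv huv]
    simp only [Nat.xor_assoc]
  have hopt : ∀ u ∈ L, ∀ v, v ∉ L → G.Adj u v → ∀ c ∈ options G F u v,
      ∃ x, IsLegal G L x ∧ grundy G (move G L x) =
        nimSum (boundary G L) (fun e => F e.1 e.2) ^^^ F u v ^^^ c := by
    intro u hu v hv huv c hc
    simp only [options, Finset.mem_insert, Finset.mem_image] at hc
    rcases hc with rfl | ⟨w, hw, rfl⟩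
    · exact ⟨v, hval u hu v hv huv⟩
    · exact ⟨w, hval' u hu v hv huv w hw⟩
  refine grundy_eq_of (fun x hx => ?_) fun m hm => ?_
  · obtain ⟨u, hu, v, hv, huv, hxv⟩ := hx.exists_adj hL hne
    obtain ⟨c, hc, hxc⟩ : ∃ c ∈ options G F u v, grundy G (move G L x) =
        nimSum (boundary G L) (fun e => F e.1 e.2) ^^^ F u v ^^^ c := by
      simp only [options, Finset.mem_insert, Finset.mem_image]
      rcases hxv with rfl | hxv
      · exact ⟨_, .inl rfl, (hval u hu x hv huv).2⟩
      · have hxc := mem_children.mpr hxv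
        exact ⟨_, .inr ⟨x, hxc, rfl⟩, (hval' u hu v hv huv x hxc).2⟩
    rw [hxc, Nat.xor_assoc]
    intro h
    have : F u v ^^^ c = 0 := by
      have := congrArg (nimSum (boundary G L) (fun e => F e.1 e.2) ^^^ ·) h
      simpa [← Nat.xor_assoc] using this
    -- An option of equal total value would make the mex `F u v` one of the options of its own
    -- branch.
    rw [Nat.xor_eq_zero_iff] at this
    rw [← this, hF L hL hsub u hu v hv huv] at hc
    exact mex_notMem _ hc
  · obtain ⟨⟨u, v⟩, he, hlt⟩ := exists_xor_lt_of_lt_nimSum hm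
    obtain ⟨hu, hv, huv⟩ := mem_boundary.mp he
    dsimp only at hu hv huv hlt
    -- The nim move lowers `F u v` to this number, which is below a mex and hence the value of an
    -- actual option.
    have hmem : m ^^^ nimSum (boundary G L) (fun e => F e.1 e.2) ^^^ F u v ∈ options G F u v := by
      refine mem_of_lt_mex ?_
      rwa [← hF L hL hsub u hu v hv huv]
    obtain ⟨x, hx, hxg⟩ := hopt u hu v hv huv _ hmem
    refine ⟨x, hx, hxg.trans ?_⟩
    generalize nimSum (boundary G L) (fun e => F e.1 e.2) = X
    rw [Nat.xor_comm (m ^^^ X), ← Nat.xor_assoc, Nat.xor_assoc X, Nat.xor_self, Nat.xor_zero,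
      Nat.xor_comm m, ← Nat.xor_assoc, Nat.xor_self, Nat.zero_xor]

/-- The Grundy values of the branches, cut off after `k` recursive steps. -/
noncomputable def edgeGrundyAux (G : SimpleGraph V) : ℕ → V → V → ℕ
  | 0 => fun _ _ => 0
  | k + 1 => fun u v => mex (options G (edgeGrundyAux G k) u v)

/-- The Grundy value of the branch at the edge `uv` (with root `u`). -/
noncomputable def edgeGrundy (G : SimpleGraph V) : V → V → ℕ :=
  edgeGrundyAux G (Nat.card V)

/-- The number of vertices on the side of `v` of the edge `uv`. -/
noncomputable def rank (G : SimpleGraph V) (u v : V) : ℕ :=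
  (side G u v).ncard

theorem rank_lt_card (u v : V) : rank G u v < Nat.card V := by
  rw [rank, ← Set.ncard_univ]
  exact Set.ncard_lt_ncard (Set.ssubset_univ_iff.mpr fun h =>
    notMem_side_left (G := G) u v (h ▸ Set.mem_univ u)) (Set.toFinite _)

theorem rank_lt_rank (hG : G.IsTree) {u v w : V} (huv : G.Adj u v) (hw : w ∈ children G u v) :
    rank G v w < rank G u v :=
  Set.ncard_lt_ncard (side_ssubset hG huv (mem_children.mp hw).1 (mem_children.mp hw).2)
    (Set.toFinite _)

/-- The options at `uv` use `F` only at edges one or two steps further out, and these have smaller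
rank. -/
theorem mex_options_congr_of_rank (hG : G.IsTree) {F F' : V → V → ℕ} {u v : V}
    (huv : G.Adj u v)
    (h : ∀ a b, G.Adj a b → rank G a b < rank G u v → F a b = F' a b) :
    mex (options G F u v) = mex (options G F' u v) := by
  rw [options_congr (fun w hw => h v w (mem_children.mp hw).1 (rank_lt_rank hG huv hw))
    fun w hw x hx => h w x (mem_children.mp hx).1
      ((rank_lt_rank hG (mem_children.mp hw).1 hx).trans (rank_lt_rank hG huv hw))]

/-- Cutting off after `k` steps does not affect edges of rank below `k`, and every rank is below
`Nat.card V`. -/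
theorem edgeGrundy_eq (hG : G.IsTree) {u v : V} (huv : G.Adj u v) :
    edgeGrundy G u v = mex (options G (edgeGrundy G) u v) := by
  have key : ∀ k u v, G.Adj u v → rank G u v < k →
      edgeGrundyAux G k u v = mex (options G (edgeGrundyAux G k) u v) := by
    intro k
    induction k with
    | zero => exact fun u v _ h => absurd h (Nat.not_lt_zero _)
    | succ k ih =>
      intro u v huv hr
      -- The right side of `ih` is by definition the cutoff at `k + 1`, so the two cutoffs agree at
      -- smaller ranks.
      exact mex_options_congr_of_rank hG huv fun a b hab h => ih a b hab (by omega)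
  exact key _ u v huv (rank_lt_card u v)

theorem grundy_eq_nimSum_edgeGrundy (hG : G.IsTree) {L : Set V} (hL : IsPosition G L)
    (hne : L.Nonempty) :
    grundy G L = nimSum (boundary G L) fun e => edgeGrundy G e.1 e.2 :=
  grundy_eq_nimSum_boundary hG (L₀ := L) _ (fun _ _ _ _ _ _ _ huv => edgeGrundy_eq hG huv) hL hne
    subset_rfl

end Boundary

/-! ### Branches correspond to boundary edges -/

section Branch

variable {V : Type*} {G : SimpleGraph V}

/-- The branch at the edge `uv`, with root `u`. -/
def edgeBranch (G : SimpleGraph V) (u v : V) : Set V :=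
  insert u (side G u v)

/-- A connected `L` containing `u` could reach the far side only through `v`. -/
theorem side_inter_eq_empty (hG : G.IsTree) {L : Set V} (hL : IsPosition G L) {u v : V}
    (hu : u ∈ L) (hv : v ∉ L) (huv : G.Adj u v) {x : V} (hx : x ∈ side G u v) : x ∉ L := by
  intro hxL
  obtain ⟨a, haL, b, hbL, hab, ha, hb⟩ :=
    exists_adj_of_preconnected hL.2 hxL hu hx (notMem_side_left u v)
  exact hv ((eq_of_adj_of_mem_side hG huv hab.symm ha hb).2 ▸ haL)

theorem edgeBranch_inter (hG : G.IsTree) {L : Set V} (hL : IsPosition G L) {u v : V}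
    (hu : u ∈ L) (hv : v ∉ L) (huv : G.Adj u v) : edgeBranch G u v ∩ L = {u} := by
  ext x
  constructor
  · rintro ⟨rfl | hx, hxL⟩
    · rfl
    · exact absurd hxL (side_inter_eq_empty hG hL hu hv huv hx)
  · rintro rfl
    exact ⟨Set.mem_insert x _, hu⟩

theorem eq_of_mem_edgeBranch_of_adj (hG : G.IsTree) {u v w : V} (huv : G.Adj u v)
    (hw : w ∈ edgeBranch G u v) (huw : G.Adj u w) : w = v := by
  rcases hw with rfl | hw
  · exact absurd rfl huw.ne
  · exact (eq_of_adj_of_mem_side hG huv huw hw (notMem_side_left u v)).2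

/-- A geodesic from a vertex of the side to `v` never leaves the side. -/
theorem connected_edgeBranch (hG : G.IsTree) {u v : V} (huv : G.Adj u v) :
    (G.induce (edgeBranch G u v)).Connected := by
  have hv : v ∈ edgeBranch G u v := Set.mem_insert_of_mem u (mem_side_right huv)
  have key : ∀ n, ∀ x (hx : x ∈ side G u v), G.dist x v = n →
      (G.induce (edgeBranch G u v)).Reachable ⟨x, Set.mem_insert_of_mem u hx⟩ ⟨v, hv⟩ := by
    intro n
    induction n with
    | zero =>
      intro x hx h0
      obtain rfl := (hG.connected x v).dist_eq_zero_iff.mp h0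
      rfl
    | succ n ih =>
      intro x hx hn
      obtain ⟨y, hxy, hy⟩ := exists_adj_dist_add_one hG.connected (x := x) (v := v)
        (by rintro rfl; simp at hn)
      have hyS : y ∈ side G u v := by
        simp only [side, Set.mem_ofPred_eq] at hx ⊢
        have h₁ := hG.connected.dist_triangle (u := x) (v := y) (w := u)
        have h₂ := SimpleGraph.dist_eq_one_iff_adj.mpr hxy
        omega
      have hadj : (G.induce (edgeBranch G u v)).Adj ⟨x, Set.mem_insert_of_mem u hx⟩
        ⟨y, Set.mem_insert_of_mem u hyS⟩ := hxy
      exact hadj.reachable.trans (ih y hyS (by omega))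
  have key' : ∀ x, (G.induce (edgeBranch G u v)).Reachable x ⟨v, hv⟩ := by
    rintro ⟨x, rfl | hx⟩
    · exact SimpleGraph.Adj.reachable (G := G.induce _) huv
    · exact key _ x hx rfl
  exact { preconnected := fun x y => (key' x).trans (key' y).symm, nonempty := ⟨v, hv⟩ }

theorem isHanging_edgeBranch (hG : G.IsTree) {L : Set V} (hL : IsPosition G L) {u v : V}
    (hu : u ∈ L) (hv : v ∉ L) (huv : G.Adj u v) : IsHanging G L (edgeBranch G u v) :=
  ⟨connected_edgeBranch hG huv, u, edgeBranch_inter hG hL hu hv huv, v,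
    ⟨Set.mem_insert_of_mem u (mem_side_right huv), huv⟩,
    fun _ hw => eq_of_mem_edgeBranch_of_adj hG huv hw.1 hw.2⟩

/-- A connected set can leave the branch only through `u`, and its sole edge at `u` leads into the
branch. This yields maximality. -/
theorem subset_edgeBranch (hG : G.IsTree) {B : Set V} (hB : (G.induce B).Connected) {u v : V}
    (hu : u ∈ B) (huv : G.Adj u v) (huniq : ∀ w ∈ B, G.Adj u w → w = v) :
    B ⊆ edgeBranch G u v := by
  intro x hx
  by_contra hxB
  obtain ⟨a, haB, b, hbB, hab, ha, hb⟩ := exists_adj_of_preconnected (D := (edgeBranch G u v)ᶜ)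
    hB.preconnected hx hu hxB (fun h => h (Set.mem_insert u _))
  simp only [edgeBranch, Set.mem_compl_iff, Set.mem_insert_iff, not_or] at ha hb
  rcases or_iff_not_and_not.mpr hb with rfl | hb
  · obtain rfl := huniq a haB hab.symm
    exact ha.2 (mem_side_right huv)
  · exact ha.1 (eq_of_adj_of_mem_side hG huv hab hb ha.2).1

/-- Each candidate set lies in the branch at the edge from its root to the root's neighbour, and
that branch is itself a candidate; so these are the maximal ones. -/
theorem isBranch_iff (hG : G.IsTree) {L : Set V} (hL : IsPosition G L) {B : Set V} :
    IsBranch G L B ↔ ∃ u ∈ L, ∃ v, v ∉ L ∧ G.Adj u v ∧ edgeBranch G u v = B := by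
  have key : ∀ B, IsHanging G L B → ∃ u ∈ L, ∃ v, v ∉ L ∧ v ∈ B ∧ G.Adj u v ∧ u ∈ B ∧
      B ⊆ edgeBranch G u v := by
    rintro B ⟨hconn, u, hBu, v, ⟨hvB, huv⟩, huniq⟩
    have hu : u ∈ B ∩ L := hBu ▸ rfl
    refine ⟨u, hu.2, v, fun hvL => huv.ne' ?_, hvB, huv, hu.1,
      subset_edgeBranch hG hconn hu.1 huv fun w hw huw => huniq w ⟨hw, huw⟩⟩
    have : v ∈ B ∩ L := ⟨hvB, hvL⟩
    rwa [hBu] at this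
  constructor
  · rintro hB
    obtain ⟨u, hu, v, hv, -, huv, -, hsub⟩ := key B hB.1
    exact ⟨u, hu, v, hv, huv, (hB.2 (isHanging_edgeBranch hG hL hu hv huv) hsub).antisymm hsub⟩
  · rintro ⟨u, hu, v, hv, huv, rfl⟩
    refine ⟨isHanging_edgeBranch hG hL hu hv huv, fun B hB hsub => ?_⟩
    have hvB : v ∈ B := hsub (Set.mem_insert_of_mem u (mem_side_right huv))
    have huB : u ∈ B := hsub (Set.mem_insert u _)
    obtain ⟨hconn, u', hBu, v', -, huniq⟩ := hB
    obtain rfl : u = u' := by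
      have : u ∈ B ∩ L := ⟨huB, hu⟩
      rwa [hBu] at this
    refine subset_edgeBranch hG hconn huB huv fun w hw huw => ?_
    rw [huniq w ⟨hw, huw⟩, huniq v ⟨hvB, huv⟩]

/-- The branch determines its root as its only labeled vertex, and `v` as the root's only neighbour
in it. -/
theorem edgeBranch_injective (hG : G.IsTree) {L : Set V} (hL : IsPosition G L) {u v u' v' : V}
    (hu : u ∈ L) (hv : v ∉ L) (huv : G.Adj u v) (hu' : u' ∈ L) (hv' : v' ∉ L) (huv' : G.Adj u' v')
    (h : edgeBranch G u v = edgeBranch G u' v') : u = u' ∧ v = v' := by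
  have h₁ := edgeBranch_inter hG hL hu hv huv
  rw [h, edgeBranch_inter hG hL hu' hv' huv', Set.singleton_eq_singleton_iff] at h₁
  subst h₁
  refine ⟨rfl, ?_⟩
  exact eq_of_mem_edgeBranch_of_adj hG huv' (h ▸ Set.mem_insert_of_mem _ (mem_side_right huv)) huv

theorem mem_edgeBranch_of_adj (hG : G.IsTree) {u v x y : V} (huv : G.Adj u v)
    (hx : x ∈ edgeBranch G u v) (hxu : x ≠ u) (hxy : G.Adj x y) : y ∈ edgeBranch G u v := by
  have hx' : x ∈ side G u v := hx.resolve_left hxu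
  by_contra hy
  simp only [edgeBranch, Set.mem_insert_iff, not_or] at hy
  exact hy.1 (eq_of_adj_of_mem_side hG huv hxy.symm hx' hy.2).1

variable [Finite V]

/-- Away from the root, vertices have the same neighbours in the branch as in `G`, so `edgeGrundy G`
obeys the recursion of the smaller tree, in which `uv` is the only edge leaving the root. -/
theorem branchGrundy_edgeBranch (hG : G.IsTree) {L : Set V} (hL : IsPosition G L) {u v : V}
    (hu : u ∈ L) (hv : v ∉ L) (huv : G.Adj u v) :
    branchGrundy G L (edgeBranch G u v) = edgeGrundy G u v := by
  set B := edgeBranch G u v with hB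
  have huB : u ∈ B := Set.mem_insert u _
  have hvB : v ∈ B := Set.mem_insert_of_mem u (mem_side_right huv)
  have hroot : {x : B | x.1 ∈ L} = {⟨u, huB⟩} := by
    ext ⟨x, hx⟩
    have := Set.ext_iff.mp (edgeBranch_inter hG hL hu hv huv) x
    simp only [Set.mem_inter_iff, ← hB, hx, true_and, Set.mem_singleton_iff] at this
    simp [this]
  have hBtree : (G.induce B).IsTree :=
    { connected := connected_edgeBranch hG huv, isAcyclic := hG.isAcyclic.induce B }
  have hchildren : ∀ a b : B, b.1 ≠ u → children G a b =
      (children (G.induce B) a b).map (Function.Embedding.subtype _) := by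
    intro a b hb
    ext w
    simp only [mem_children, Finset.mem_map, SimpleGraph.comap_adj, Function.Embedding.subtype_apply,
      ne_eq, Subtype.exists, exists_and_right, exists_eq_right]
    constructor
    · rintro ⟨h₁, h₂⟩
      exact ⟨mem_edgeBranch_of_adj hG huv b.2 hb h₁, h₁, fun h => h₂ (congrArg Subtype.val h)⟩
    · rintro ⟨hw, h₁, h₂⟩
      exact ⟨h₁, fun h => h₂ (Subtype.ext h)⟩
  have hrest : ∀ a b : B, b.1 ≠ u → rest (G.induce B) (fun x y => edgeGrundy G x y) a b =
      rest G (edgeGrundy G) a b := by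
    intro a b hb
    rw [rest, rest, hchildren a b hb]
    simp [nimSum, Finset.fold_map, Function.comp_def]
  -- The recursion is needed only for positions containing the root: at an edge into the root, the
  -- children in `G` may lie outside the branch.
  have hrec : ∀ M, IsPosition (G.induce B) M → {⟨u, huB⟩} ⊆ M → ∀ a ∈ M, ∀ b, b ∉ M →
      (G.induce B).Adj a b → edgeGrundy G a b =
        mex (options (G.induce B) (fun x y => edgeGrundy G x y) a b) := by
    intro M hM hsub a ha b hb hab
    have hne : ∀ c : B, c ∉ M → c.1 ≠ u := fun c hc h => hc (hsub (Subtype.ext h))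
    rw [edgeGrundy_eq hG (show G.Adj a.1 b.1 from hab)]
    congr 1
    unfold options
    rw [hrest a b (hne b hb), hchildren a b (hne b hb)]
    congr 1
    ext c
    simp only [Finset.mem_image, Finset.mem_map, Function.Embedding.subtype_apply,
      exists_exists_and_eq_and]
    refine exists_congr fun w => and_congr_right fun hw => ?_
    rw [mem_children] at hw
    have hwM : w ∉ M := fun h => hw.2 (hM.1.eq_of_adj hb h ha hw.1 hab.symm)
    rw [hrest b w (hne w hwM)]
  have hpos : IsPosition (G.induce B) {⟨u, huB⟩} := by
    have : ((G.induce B).induce {⟨u, huB⟩}).Preconnected := fun a b => by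
      rw [Subsingleton.elim a b]
    exact ⟨isP3Closed_of_preconnected hBtree this, this⟩
  rw [branchGrundy, hroot, grundy_eq_nimSum_boundary hBtree _ hrec hpos ⟨_, rfl⟩ subset_rfl]
  have hbd : boundary (G.induce B) {⟨u, huB⟩} = {(⟨u, huB⟩, ⟨v, hvB⟩)} := by
    ext ⟨⟨a, ha⟩, ⟨b, hb⟩⟩
    simp only [mem_boundary, Set.mem_singleton_iff, SimpleGraph.comap_adj,
      Function.Embedding.subtype_apply, Finset.mem_singleton, Prod.mk.injEq, Subtype.mk.injEq]
    constructor
    · rintro ⟨rfl, h₁, h₂⟩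
      exact ⟨rfl, eq_of_mem_edgeBranch_of_adj hG huv hb h₂⟩
    · rintro ⟨rfl, rfl⟩
      exact ⟨rfl, huv.ne', huv⟩
  rw [hbd]
  simp [nimSum]

theorem grundy_eq_nimSum_branchGrundy (hG : G.IsTree) {L : Set V} (hne : L.Nonempty)
    (hL : IsPosition G L) :
    grundy G L = nimSum (branches G L) (branchGrundy G L) := by
  classical
  have hset : branches G L = (boundary G L).image fun e => edgeBranch G e.1 e.2 := by
    ext B
    simp [branches, isBranch_iff hG hL, and_assoc]
  rw [hset, nimSum_image, grundy_eq_nimSum_edgeGrundy hG hL hne]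
  · refine nimSum_congr fun e he => ?_
    rw [mem_boundary] at he
    exact (branchGrundy_edgeBranch hG hL he.1 he.2.1 he.2.2).symm
  · intro e he e' he' h
    rw [Finset.mem_coe, mem_boundary] at he he'
    obtain ⟨h₁, h₂⟩ := edgeBranch_injective hG hL he.1 he.2.1 he.2.2 he'.1 he'.2.1 he'.2.2 h
    exact Prod.ext h₁ h₂

end Branch

end P3Game

/-! ### Correctness of the machine arithmetic -/

namespace RAM

theorem powTwo_eq {n k : ℕ} (h : k ≤ n) : powTwo n k = 2 ^ k := by
  refine dfold_induction (fun i x => x = 2 ^ (k - i)) (by simp [Nat.sub_eq_zero_of_le h]) ?_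
  rintro i - x rfl
  split_ifs with hi
  · rw [← Nat.two_mul, ← pow_succ', show k - (i + 1) + 1 = k - i by omega]
  · rw [show k - (i + 1) = k - i by omega]

theorem lowBits_eq {n a k : ℕ} (ha : a < 2 ^ n) (hk : k < n) :
    lowBits n a k = a % 2 ^ (k + 1) := by
  have := dfold_induction (n := n) (b := a) (step := fun i r =>
      if k < i ∧ ¬ r < powTwo n i then r - powTwo n i else r)
    -- Descending rounds strip the bits above `k` one by one; rounds `i ≤ k` do nothing.
    (fun i r => r = a % 2 ^ max i (k + 1))
    (by rw [max_eq_left (by omega), Nat.mod_eq_of_lt ha]) ?_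
  · rw [lowBits, this, max_eq_right (Nat.zero_le _)]
  · rintro i hi r rfl
    rw [powTwo_eq hi.le]
    by_cases hki : k < i
    · rw [max_eq_left (by omega), max_eq_left (by omega), Nat.mod_pow_succ]
      have h₁ := Nat.mod_lt a (Nat.two_pow_pos i)
      rcases Nat.mod_two_eq_zero_or_one (a / 2 ^ i) with h | h
      · simp [h, h₁]
      · simp [h, hki]
    · rw [max_eq_right (by omega), max_eq_right (by omega), if_neg (by tauto)]

/-- Bit `k` is the leading bit of the residue modulo `2 ^ (k + 1)`, so a comparison with `2 ^ k`
reads it without division. -/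
theorem lowBits_lt_iff {n a k : ℕ} (ha : a < 2 ^ n) (hk : k < n) :
    lowBits n a k < powTwo n k ↔ a.testBit k = false := by
  rw [lowBits_eq ha hk, powTwo_eq hk.le, Nat.mod_pow_succ, Nat.testBit_eq_decide_div_mod_eq]
  have h₁ := Nat.mod_lt a (Nat.two_pow_pos k)
  rcases Nat.mod_two_eq_zero_or_one (a / 2 ^ k) with h | h <;> simp [h, h₁]

theorem xorVal_eq {n a b : ℕ} (ha : a < 2 ^ n) (hb : b < 2 ^ n) : xorVal n a b = a ^^^ b := by
  have := dfold_induction (n := n) (b := 0) (step := fun k x => x + if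
      (if lowBits n a k < powTwo n k then 0 else 1) ≠ (if lowBits n b k < powTwo n k then 0 else 1)
      -- Invariant: the accumulator is `a ^^^ b` with the bits below `k` cleared.
      then powTwo n k else 0) (fun k x => x = 2 ^ k * ((a ^^^ b) / 2 ^ k))
    (by rw [Nat.div_eq_of_lt (Nat.xor_lt_two_pow ha hb), mul_zero]) ?_
  · rw [xorVal, this]; simp
  · rintro k hk x rfl
    have hbit : ((if lowBits n a k < powTwo n k then 0 else 1) ≠
        (if lowBits n b k < powTwo n k then 0 else 1)) ↔ (a ^^^ b) / 2 ^ k % 2 = 1 := by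
      have := Nat.testBit_eq_decide_div_mod_eq (x := a ^^^ b) (i := k)
      rw [Nat.testBit_xor] at this
      simp only [lowBits_lt_iff ha hk, lowBits_lt_iff hb hk]
      rw [← decide_eq_true_iff (p := _ % 2 = 1), ← this]
      cases a.testBit k <;> cases b.testBit k <;> simp
    have hdiv : (a ^^^ b) / 2 ^ (k + 1) = (a ^^^ b) / 2 ^ k / 2 := by
      rw [pow_succ, Nat.div_div_eq_div_mul]
    simp only [hbit]
    rw [powTwo_eq hk.le, hdiv, pow_succ]
    generalize (a ^^^ b) / 2 ^ k = c
    conv_rhs => rw [← Nat.div_add_mod c 2]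
    split_ifs with h
    · rw [h]; ring
    · rw [show c % 2 = 0 by omega]; ring

theorem address_eq {n i : ℕ} (b j : ℕ) (h : i ≤ n) : address n b i j = b + (i * n + j) := by
  have := dfold_induction (n := n) (b := j) (step := fun k x => if k < i then x + n else x)
    (fun k x => x = (i - k) * n + j) (by simp [Nat.sub_eq_zero_of_le h]) ?_
  · simpa [address] using this
  · rintro k - x rfl
    split_ifs with hk
    · rw [show i - k = i - (k + 1) + 1 by omega]; ring
    · rw [show i - (k + 1) = i - k by omega]

end RAM

namespace P3Game

theorem nimSum_lt_two_pow {ι : Type*} {s : Finset ι} {f : ι → ℕ} {n : ℕ}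
    (h : ∀ i ∈ s, f i < 2 ^ n) : nimSum s f < 2 ^ n := by
  classical
  induction s using Finset.induction_on with
  | empty => exact Nat.two_pow_pos n
  | insert i s hi ih =>
    rw [nimSum_insert hi]
    exact Nat.xor_lt_two_pow (h i (Finset.mem_insert_self i s))
      (ih fun j hj => h j (Finset.mem_insert_of_mem hj))

end P3Game

/-! ### Correctness of the table -/

namespace RAM

open P3Game

/-- Translates machine loops into nim-sums over finite sets. All bounds by `2 ^ n` are there because
`xorVal` handles `n` bits only. -/
theorem dfold_xorVal {n : ℕ} {p : ℕ → Prop} [DecidablePred p] {f : ℕ → ℕ} (s : Finset (Fin n))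
    (F : Fin n → ℕ) (hs : ∀ i : Fin n, p i ↔ i ∈ s) (hf : ∀ i : Fin n, f i = F i)
    (hF : ∀ i, F i < 2 ^ n) {x : ℕ} (hx : x < 2 ^ n) :
    dfold n (fun w y => if p w then xorVal n y (f w) else y) x = x ^^^ nimSum s F := by
  have hsum : ∀ t : Finset (Fin n), nimSum t F < 2 ^ n := fun t => nimSum_lt_two_pow fun i _ => hF i
  have := dfold_induction (n := n) (b := x)
    (step := fun w y => if p w then xorVal n y (f w) else y)
    (fun k y => y = x ^^^ nimSum (s.filter fun i => k ≤ i.1) F) ?_ ?_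
  · simpa using this
  · rw [Finset.filter_false_of_mem fun i _ => by omega]; simp [nimSum_empty]
  · rintro k hk y rfl
    by_cases hp : p k
    · have hks := (hs ⟨k, hk⟩).mp hp
      have : s.filter (fun i => k ≤ i.1) = insert ⟨k, hk⟩ (s.filter fun i => k + 1 ≤ i.1) := by
        ext i
        simp only [Finset.mem_filter, Finset.mem_insert, Fin.ext_iff]
        constructor
        · rintro ⟨h₁, h₂⟩
          rcases Nat.eq_or_lt_of_le h₂ with h | h
          · exact .inl h.symm
          · exact .inr ⟨h₁, h⟩
        · rintro (h | ⟨h₁, h₂⟩)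
          · rw [show i = ⟨k, hk⟩ from Fin.ext h]; exact ⟨hks, le_rfl⟩
          · exact ⟨h₁, by omega⟩
      rw [if_pos hp, this, nimSum_insert (by simp), hf ⟨k, hk⟩,
        xorVal_eq (Nat.xor_lt_two_pow hx (hsum _)) (hF _), Nat.xor_assoc, Nat.xor_comm (F _)]
    · have : s.filter (fun i => k ≤ i.1) = s.filter fun i => k + 1 ≤ i.1 := by
        refine Finset.filter_congr fun i hi => ⟨fun h => ?_, fun h => by omega⟩
        refine Nat.lt_of_le_of_ne h fun h' => hp ?_
        rw [h']; exact (hs i).mpr hi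
      rw [if_neg hp, this]

/-- The state contains the graph `G`, the labeled set `L`, and the table `F`. -/
structure Represents {n : ℕ} (G : SimpleGraph (Fin n)) (L : Set (Fin n))
    (F : Fin n → Fin n → ℕ) (s : State) : Prop where
  size : s.reg 0 = n
  adj : ∀ i j : Fin n, s.mem (i.1 * n + j.1) ≠ 0 ↔ G.Adj i j
  label : ∀ i : Fin n, s.mem (n * n + i.1) ≠ 0 ↔ i ∈ L
  table : ∀ i j : Fin n, s.mem (n * n + n + (i.1 * n + j.1)) = F i j
  bound : ∀ i j, F i j < 2 ^ n

theorem mul_add_lt_mul {n : ℕ} (i j : Fin n) : i.1 * n + j.1 < n * n :=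
  calc i.1 * n + j.1 < i.1 * n + n := by omega
    _ = (i.1 + 1) * n := by ring
    _ ≤ n * n := Nat.mul_le_mul_right n i.2

theorem eq_of_mul_add_eq {n : ℕ} {i j i' j' : Fin n} (h : i.1 * n + j.1 = i'.1 * n + j'.1) :
    i = i' ∧ j = j' := by
  have hn : 0 < n := i.pos
  have h₁ := congrArg (· / n) h
  have h₂ := congrArg (· % n) h
  simp only [Nat.mul_add_mod_of_lt, j.2, j'.2] at h₂
  simp only [Nat.add_comm (_ * n), Nat.add_mul_div_right _ _ hn, Nat.div_eq_of_lt j.2,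
    Nat.div_eq_of_lt j'.2, zero_add] at h₁
  exact ⟨Fin.ext h₁, Fin.ext h₂⟩

theorem represents_input {n : ℕ} (G : SimpleGraph (Fin n)) (L : Set (Fin n)) :
    Represents G L (fun _ _ => 0) (input G L) where
  size := rfl
  adj i j := by
    simp only [input, ne_eq, ite_eq_right_iff, one_ne_zero, imp_false, not_not]
    constructor
    · rintro (⟨i', j', h, he⟩ | ⟨i', -, he⟩)
      · obtain ⟨rfl, rfl⟩ := eq_of_mul_add_eq he
        exact h
      · have := mul_add_lt_mul i j
        omega
    · exact fun h => .inl ⟨i, j, h, rfl⟩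
  label i := by
    simp only [input, ne_eq, ite_eq_right_iff, one_ne_zero, imp_false, not_not]
    constructor
    · rintro (⟨i', j', h, he⟩ | ⟨i', hi', he⟩)
      · have := mul_add_lt_mul i' j'
        omega
      · rwa [show i = i' from Fin.ext (by omega)]
    · exact fun h => .inr ⟨i, h, rfl⟩
  table i j := by
    simp only [input, ite_eq_right_iff, one_ne_zero, imp_false, not_or, not_exists, not_and]
    refine ⟨fun i' j' _ he => ?_, fun i' _ he => ?_⟩
    · have := mul_add_lt_mul i' j'
      omega
    · omega
  bound _ _ := Nat.two_pow_pos n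

namespace Represents

variable {n : ℕ} {G : SimpleGraph (Fin n)} {L : Set (Fin n)} {F : Fin n → Fin n → ℕ} {s : State}

theorem adjVal_ne_zero (h : Represents G L F s) (i j : Fin n) :
    adjVal n s.mem i j ≠ 0 ↔ G.Adj i j := by
  rw [adjVal, address_eq _ _ i.2.le, zero_add, h.adj]

theorem labelVal_ne_zero (h : Represents G L F s) (i : Fin n) :
    labelVal n s.mem i ≠ 0 ↔ i ∈ L := by
  rw [labelVal, address_eq _ _ le_rfl, zero_add, h.label]

theorem tableAddr_eq (i : Fin n) (j : ℕ) : tableAddr n i j = n * n + n + (i.1 * n + j) := by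
  rw [tableAddr, address_eq _ _ i.2.le, address_eq _ _ le_rfl]; ring

theorem tableVal_eq (h : Represents G L F s) (i j : Fin n) : tableVal n s.mem i j = F i j := by
  rw [tableVal, tableAddr_eq, h.table]

theorem rest_lt (h : Represents G L F s) (u v : Fin n) : rest G F u v < 2 ^ n :=
  nimSum_lt_two_pow fun i _ => h.bound v i

theorem restVal_eq (h : Represents G L F s) (u v : Fin n) : restVal n s.mem u v = rest G F u v := by
  rw [restVal, dfold_xorVal (children G u v) (F v) (fun w => ?_) (fun w => h.tableVal_eq v w)
    (h.bound v) (Nat.two_pow_pos n), Nat.zero_xor, rest]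
  rw [h.adjVal_ne_zero v w, mem_children, ne_eq, ne_eq, Fin.ext_iff]

theorem optionVal_ne_zero (h : Represents G L F s) (u v : Fin n) (c : ℕ) :
    optionVal n s.mem u v c ≠ 0 ↔ c ∈ options G F u v := by
  have := dfold_induction (n := n) (b := if restVal n s.mem u v = c then 1 else 0)
    (step := fun w x => if (adjVal n s.mem v w ≠ 0 ∧ w ≠ u) ∧
      xorVal n (xorVal n (restVal n s.mem u v) (tableVal n s.mem v w)) (restVal n s.mem v w) = c
      then 1 else x)
    (fun k x => x ≠ 0 ↔ rest G F u v = c ∨ ∃ w ∈ children G u v, k ≤ w.1 ∧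
      rest G F u v ^^^ F v w ^^^ rest G F v w = c) ?_ ?_
  · rw [optionVal, this]
    simp [options, eq_comm]
  · rw [h.restVal_eq]
    simp
  · intro k hk x hx
    have hk' := h.adjVal_ne_zero v ⟨k, hk⟩
    have hk₁ := h.tableVal_eq v ⟨k, hk⟩
    have hk₂ := h.restVal_eq v ⟨k, hk⟩
    dsimp only at hk' hk₁ hk₂
    have hcond : ((adjVal n s.mem v k ≠ 0 ∧ k ≠ u) ∧
        xorVal n (xorVal n (restVal n s.mem u v) (tableVal n s.mem v k)) (restVal n s.mem v k) = c)
        ↔ (⟨k, hk⟩ : Fin n) ∈ children G u v ∧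
          rest G F u v ^^^ F v ⟨k, hk⟩ ^^^ rest G F v ⟨k, hk⟩ = c := by
      rw [hk', hk₁, hk₂, h.restVal_eq, xorVal_eq (h.rest_lt u v) (h.bound _ _),
        xorVal_eq (Nat.xor_lt_two_pow (h.rest_lt u v) (h.bound _ _)) (h.rest_lt _ _), mem_children,
        ne_eq, ne_eq, Fin.ext_iff]
    simp only [hcond]
    split_ifs with hc
    · simp only [ne_eq, one_ne_zero, not_false_eq_true, true_iff]
      exact .inr ⟨_, hc.1, le_rfl, hc.2⟩
    · rw [hx]
      refine or_congr_right (exists_congr fun w => and_congr_right fun hw => ?_)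
      refine and_congr_left fun hwc => ⟨fun h => by omega, fun h => ?_⟩
      refine Nat.lt_of_le_of_ne h fun h' => hc ?_
      rw [show (⟨k, hk⟩ : Fin n) = w from Fin.ext h']
      exact ⟨hw, hwc⟩

theorem mexVal_eq (h : Represents G L F s) (u v : Fin n) :
    mexVal n s.mem u v = mex (options G F u v) := by
  have := dfold_induction (n := n) (b := 0)
    (step := fun _ c => if optionVal n s.mem u v c ≠ 0 then c + 1 else c)
    -- The candidate rises by one per round until it is not an option, then stays; the mex is at
    -- most `n`, so `n` rounds suffice.
    (fun k x => x = min (mex (options G F u v)) (n - k)) (by simp) ?_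
  · have hcard := (mex_le_card _).trans (card_options_le G F u v)
    rw [Fintype.card_fin] at hcard
    rw [mexVal, this, Nat.sub_zero, min_eq_left hcard]
  · rintro k hk x rfl
    simp only [h.optionVal_ne_zero]
    split_ifs with hc
    · have hne : min (mex (options G F u v)) (n - (k + 1)) ≠ mex (options G F u v) := fun he =>
        mex_notMem _ (he ▸ hc)
      omega
    · have hle : ¬ min (mex (options G F u v)) (n - (k + 1)) < mex (options G F u v) := fun hlt =>
        hc (mem_of_lt_mex hlt)
      omega

theorem update (h : Represents G L F s) (u v : Fin n) :
    Represents G L (fun i j => if i = u ∧ j = v then mex (options G F u v) else F i j)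
      (RAM.update s u v) := by
  have hmem : (RAM.update s u v).mem =
      Function.update s.mem (n * n + n + (u.1 * n + v.1)) (mex (options G F u v)) := by
    rw [RAM.update, State.setMem_mem, h.size, tableAddr_eq, h.mexVal_eq]
  refine ⟨h.size, fun i j => ?_, fun i => ?_, fun i j => ?_, fun i j => ?_⟩
  · have := mul_add_lt_mul i j
    rw [hmem, Function.update_of_ne (by omega), h.adj]
  · rw [hmem, Function.update_of_ne (by omega), h.label]
  · rw [hmem]
    split_ifs with hij
    · rw [hij.1, hij.2, Function.update_self]
    · rw [Function.update_of_ne, h.table]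
      exact fun he => hij (eq_of_mul_add_eq (by omega))
  · have hcard := (mex_le_card _).trans (card_options_le G F u v)
    rw [Fintype.card_fin] at hcard
    split_ifs
    · exact hcard.trans_lt n.lt_two_pow_self
    · exact h.bound i j

theorem positionVal_eq (h : Represents G L F s) :
    positionVal n s.mem = nimSum (boundary G L) fun e => F e.1 e.2 := by
  classical
  have hlt : ∀ t : Finset (Fin n × Fin n), nimSum t (fun e => F e.1 e.2) < 2 ^ n := fun t =>
    nimSum_lt_two_pow fun e _ => h.bound _ _
  have := dfold_induction (n := n) (b := 0)
    (step := fun u x => dfold n (fun v x =>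
      if (labelVal n s.mem u ≠ 0 ∧ labelVal n s.mem v = 0) ∧ adjVal n s.mem u v ≠ 0
      then xorVal n x (tableVal n s.mem u v) else x) x)
    (fun k x => x = nimSum ((boundary G L).filter fun e => k ≤ e.1.1) fun e => F e.1 e.2) ?_ ?_
  · rw [positionVal, this]; simp
  · rw [Finset.filter_false_of_mem fun e _ => by omega, nimSum_empty]
  · rintro k hk x rfl
    let u : Fin n := ⟨k, hk⟩
    let t : Finset (Fin n) := Finset.univ.filter fun v => (u, v) ∈ boundary G L
    rw [dfold_xorVal t (F u) (fun v => ?_) (fun v => h.tableVal_eq u v) (h.bound u) (hlt _)]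
    · have : (boundary G L).filter (fun e => k ≤ e.1.1) =
          (boundary G L).filter (fun e => k + 1 ≤ e.1.1) ∪ t.image (Prod.mk u) := by
        ext ⟨a, b⟩
        simp only [t, Finset.mem_filter, Finset.mem_union, Finset.mem_image, Finset.mem_univ,
          true_and, Prod.mk.injEq]
        constructor
        · rintro ⟨h₁, h₂⟩
          rcases Nat.eq_or_lt_of_le h₂ with h | h
          · obtain rfl : u = a := Fin.ext h
            exact .inr ⟨b, h₁, rfl, rfl⟩
          · exact .inl ⟨h₁, h⟩
        · rintro (⟨h₁, h₂⟩ | ⟨_, h₁, rfl, rfl⟩)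
          · exact ⟨h₁, by omega⟩
          · exact ⟨h₁, le_rfl⟩
      rw [this, nimSum_union, nimSum_image (Prod.mk_right_injective u).injOn]
      rw [Finset.disjoint_left]
      rintro ⟨a, b⟩ h₁ h₂
      simp only [Finset.mem_filter, Finset.mem_image, Prod.mk.injEq] at h₁ h₂
      obtain ⟨_, -, rfl, -⟩ := h₂
      exact absurd h₁.2 (by simp [u])
    · have h₁ := h.labelVal_ne_zero u
      have h₂ := h.labelVal_ne_zero v
      have h₃ := h.adjVal_ne_zero u v
      simp only [u] at h₁ h₃
      simp only [t, Finset.mem_filter, Finset.mem_univ, true_and, mem_boundary]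
      rw [h₁, h₃, ← not_not (a := labelVal n s.mem v = 0), ← ne_eq, h₂, and_assoc]

theorem vertexVal_eq (h : Represents G L F s) (u : Fin n) :
    vertexVal n s.mem u = nimSum (boundary G {u}) fun e => F e.1 e.2 := by
  classical
  rw [vertexVal, dfold_xorVal (Finset.univ.filter fun v => G.Adj u v) (F u) (fun v => ?_)
    (fun v => h.tableVal_eq u v) (h.bound u) (Nat.two_pow_pos n), Nat.zero_xor]
  · have : boundary G {u} = (Finset.univ.filter fun v => G.Adj u v).image (Prod.mk u) := by
      ext ⟨a, b⟩
      simp only [mem_boundary, Set.mem_singleton_iff, Finset.mem_image, Finset.mem_filter,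
        Finset.mem_univ, true_and, Prod.mk.injEq]
      constructor
      · rintro ⟨rfl, -, hab⟩
        exact ⟨b, hab, rfl, rfl⟩
      · rintro ⟨_, hab, rfl, rfl⟩
        exact ⟨rfl, hab.ne', hab⟩
    rw [this, nimSum_image (Prod.mk_right_injective u).injOn]
  · simp [h.adjVal_ne_zero u v]

theorem winVal_eq (h : Represents G L F s)
    [Decidable (∃ u, nimSum (boundary G {u}) (fun e => F e.1 e.2) = 0)] :
    winVal n s.mem = if ∃ u, nimSum (boundary G {u}) (fun e => F e.1 e.2) = 0 then 1 else 0 := by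
  classical
  have := dfold_induction (n := n) (b := 0)
    (step := fun u x => if vertexVal n s.mem u = 0 then 1 else x)
    (fun k x => x = if ∃ u : Fin n, k ≤ u.1 ∧ vertexVal n s.mem u = 0 then 1 else 0) ?_ ?_
  · rw [winVal, this]
    simp [h.vertexVal_eq]
  · rw [if_neg]
    rintro ⟨u, hu, -⟩
    omega
  · rintro k hk x rfl
    by_cases h0 : vertexVal n s.mem k = 0
    · rw [if_pos h0, if_pos ⟨⟨k, hk⟩, le_rfl, h0⟩]
    · rw [if_neg h0]
      congr 1
      refine propext (exists_congr fun u => and_congr_left fun hu => ⟨fun h => by omega, fun h => ?_⟩)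
      exact Nat.lt_of_le_of_ne h fun h' => h0 (h' ▸ hu)

end Represents

/-- The state contains a table with the Grundy values of all branches of rank less than `k`, and
of those of rank `k` at the edges in `P`. -/
def TableUpTo {n : ℕ} (G : SimpleGraph (Fin n)) (L : Set (Fin n)) (k : ℕ)
    (P : Fin n → Fin n → Prop) (s : State) : Prop :=
  ∃ F, Represents G L F s ∧ ∀ u v, G.Adj u v → (rank G u v < k ∨ rank G u v = k ∧ P u v) →
    F u v = edgeGrundy G u v

variable {n : ℕ} {G : SimpleGraph (Fin n)} {L : Set (Fin n)} {k : ℕ} {s : State}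

theorem TableUpTo.size {P : Fin n → Fin n → Prop} (h : TableUpTo G L k P s) : s.reg 0 = n := by
  obtain ⟨F, hF, -⟩ := h
  exact hF.size

/-- The new entry is right because its options use smaller ranks only, whose entries are correct;
recomputing a correct entry is harmless, so the order within a sweep is immaterial. Entries at
non-edges are never constrained. -/
theorem TableUpTo.update (hG : G.IsTree) {P Q : Fin n → Fin n → Prop} (h : TableUpTo G L k P s)
    (u v : Fin n) (hQ : ∀ a b, Q a b → P a b ∨ a = u ∧ b = v) :
    TableUpTo G L k Q (update s u v) := by
  obtain ⟨F, hF, hval⟩ := h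
  refine ⟨_, hF.update u v, fun a b hab hr => ?_⟩
  split_ifs with he
  · obtain ⟨rfl, rfl⟩ := he
    rw [edgeGrundy_eq hG hab]
    exact mex_options_congr_of_rank hG hab fun c d hcd hlt => hval c d hcd (.inl (by omega))
  · exact hval a b hab (hr.imp_right fun h => ⟨h.1, (hQ a b h.2).resolve_right he⟩)

theorem TableUpTo.updateRow (hG : G.IsTree) {P Q : Fin n → Fin n → Prop}
    (h : TableUpTo G L k P s) (u : Fin n) (hQ : ∀ a b, Q a b → P a b ∨ a = u) (i : ℕ) :
    TableUpTo G L k Q (updateRow ((s, i), u)).1.1 := by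
  have := dfold_induction (n := n) (b := ((s, i), u.1))
    (step := fun v x => ((RAM.update x.1.1 x.2 v, x.1.2), x.2))
    (fun j x => x.2 = u.1 ∧ TableUpTo G L k (fun a b => P a b ∨ a = u ∧ j ≤ b.1) x.1.1) ?_ ?_
  · obtain ⟨F, hF, hval⟩ := this.2
    rw [RAM.updateRow, h.size]
    exact ⟨F, hF, fun a b hab hr => hval a b hab
      (hr.imp_right fun h => ⟨h.1, (hQ a b h.2).imp_right fun h => ⟨h, Nat.zero_le _⟩⟩)⟩
  · obtain ⟨F, hF, hval⟩ := h
    exact ⟨rfl, F, hF, fun a b hab hr => hval a b hab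
      (hr.imp_right fun h => ⟨h.1, h.2.resolve_right fun h => by omega⟩)⟩
  · rintro j hj ⟨⟨s', i'⟩, u'⟩ ⟨rfl, hs'⟩
    refine ⟨rfl, hs'.update hG u ⟨j, hj⟩ ?_⟩
    rintro a b (hab | ⟨rfl, hb⟩)
    · exact .inl (.inl hab)
    · rcases Nat.eq_or_lt_of_le hb with h | h
      · exact .inr ⟨rfl, Fin.ext h.symm⟩
      · exact .inl (.inr ⟨rfl, h⟩)

theorem TableUpTo.sweep (hG : G.IsTree) (h : TableUpTo G L k (fun _ _ => False) s) (i : ℕ) :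
    TableUpTo G L (k + 1) (fun _ _ => False) (sweep (s, i)).1 := by
  have := dfold_induction (n := n) (b := (s, i))
    (step := fun u x => (RAM.updateRow (x, u)).1)
    (fun j x => TableUpTo G L k (fun a _ => j ≤ a.1) x.1) ?_ ?_
  · obtain ⟨F, hF, hval⟩ := this
    rw [RAM.sweep, h.size]
    exact ⟨F, hF, fun a b hab hr => hval a b hab (by simp at hr ⊢; omega)⟩
  · obtain ⟨F, hF, hval⟩ := h
    exact ⟨F, hF, fun a b hab hr => hval a b hab (by have := a.2; simp at hr ⊢; omega)⟩
  · rintro j hj ⟨s', i'⟩ hs'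
    refine hs'.updateRow hG ⟨j, hj⟩ (fun a b hab => ?_) i'
    rcases Nat.eq_or_lt_of_le hab with h | h
    · exact .inr (Fin.ext h.symm)
    · exact .inl h

/-- The filled table contains the Grundy values of all branches. -/
theorem exists_represents_fill (hG : G.IsTree) (L : Set (Fin n)) :
    ∃ F, Represents G L F (fill (input G L)) ∧ ∀ u v, G.Adj u v → F u v = edgeGrundy G u v := by
  have := dfold_induction (n := n) (b := input G L) (step := fun i s => (RAM.sweep (s, i)).1)
    (fun j s => TableUpTo G L (n - j) (fun _ _ => False) s) ?_ ?_
  · obtain ⟨F, hF, hval⟩ := this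
    -- After `n` sweeps all ranks below `n` are correct, and these are all ranks.
    refine ⟨F, hF, fun u v huv => hval u v huv (.inl ?_)⟩
    simpa using rank_lt_card (G := G) u v
  · exact ⟨_, represents_input G L, fun u v _ hr => by simp at hr⟩
  · intro j hj s hs
    rw [show n - j = n - (j + 1) + 1 by omega]
    exact hs.sweep hG j

end RAM

open P3Game RAM in
theorem exists_program_grundy : ∃ (P : RAM.Program) (p : Polynomial ℕ),
    ∀ (n : ℕ) (G : SimpleGraph (Fin n)), G.IsTree → ∀ L : Set (Fin n), L.Nonempty →
      P3Game.IsPosition G L → RAM.Outputs P (RAM.input G L) (p.eval n) (P3Game.grundy G L) := by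
  obtain ⟨P, p, h⟩ := exists_program (Comp.positionVal (C := Ctx.base))
  refine ⟨P, p, fun n G hG L hne hL => ?_⟩
  obtain ⟨F, hF, hval⟩ := exists_represents_fill hG L
  have hout := h (input G L)
  have hpos : positionVal (Ctx.base.size (fill (input G L))) (Ctx.base.mem (fill (input G L))) =
      grundy G L := by
    rw [show Ctx.base.size (fill (input G L)) = n from hF.size,
      show Ctx.base.mem (fill (input G L)) = (fill (input G L)).mem from rfl, hF.positionVal_eq,
      grundy_eq_nimSum_edgeGrundy hG hL hne]
    exact nimSum_congr fun e he => hval _ _ (mem_boundary.mp he).2.2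
  rw [hpos] at hout
  exact hout

-- The table depends on the tree only, so filling it once serves all singletons that the first move
-- can produce.
open P3Game RAM in
theorem exists_program_firstPlayerWins : ∃ (P : RAM.Program) (p : Polynomial ℕ),
    ∀ (n : ℕ) (G : SimpleGraph (Fin n)), G.IsTree →
      (P3Game.FirstPlayerWins G → RAM.Outputs P (RAM.input G ∅) (p.eval n) 1) ∧
      (¬ P3Game.FirstPlayerWins G → RAM.Outputs P (RAM.input G ∅) (p.eval n) 0) := by
  classical
  obtain ⟨P, p, h⟩ := exists_program (Comp.winVal (C := Ctx.base))
  refine ⟨P, p, fun n G hG => ?_⟩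
  obtain ⟨F, hF, hval⟩ := exists_represents_fill hG ∅
  have hout := h (input G ∅)
  have hsum : ∀ u, nimSum (boundary G {u}) (fun e => F e.1 e.2) = grundy G {u} := by
    intro u
    have hpre : (G.induce {u}).Preconnected := fun a b => by rw [Subsingleton.elim a b]
    rw [grundy_eq_nimSum_edgeGrundy hG ⟨isP3Closed_of_preconnected hG hpre, hpre⟩
      (Set.singleton_nonempty u)]
    exact nimSum_congr fun e he => hval _ _ (mem_boundary.mp he).2.2
  have hwin : winVal (Ctx.base.size (fill (input G ∅))) (Ctx.base.mem (fill (input G ∅))) =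
      if FirstPlayerWins G then 1 else 0 := by
    rw [show Ctx.base.size (fill (input G ∅)) = n from hF.size,
      show Ctx.base.mem (fill (input G ∅)) = (fill (input G ∅)).mem from rfl, hF.winVal_eq]
    simp only [hsum, firstPlayerWins_iff hG]
  rw [hwin] at hout
  exact ⟨fun hw => by rwa [if_pos hw] at hout, fun hw => by rwa [if_neg hw] at hout⟩

/-- The connected `P₃`-game on trees: the winner is decided in polynomial time; the Grundy values
of the positions (labeled subtrees) are computed in polynomial time; and the Grundy value of a
position is the nim-sum of the Grundy values of its branches. -/
theorem mainTheorem1 :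
    (∃ (P : RAM.Program) (p : Polynomial ℕ), ∀ (n : ℕ) (G : SimpleGraph (Fin n)), G.IsTree →
      (P3Game.FirstPlayerWins G → RAM.Outputs P (RAM.input G ∅) (p.eval n) 1) ∧
      (¬ P3Game.FirstPlayerWins G → RAM.Outputs P (RAM.input G ∅) (p.eval n) 0)) ∧
    (∃ (P : RAM.Program) (p : Polynomial ℕ), ∀ (n : ℕ) (G : SimpleGraph (Fin n)), G.IsTree →
      ∀ L : Set (Fin n), L.Nonempty → P3Game.IsPosition G L →
        RAM.Outputs P (RAM.input G L) (p.eval n) (P3Game.grundy G L)) ∧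
    (∀ (V : Type*) [Finite V] (G : SimpleGraph V), G.IsTree →
      ∀ L : Set V, L.Nonempty → P3Game.IsPosition G L →
        P3Game.grundy G L =
          P3Game.nimSum (P3Game.branches G L) (P3Game.branchGrundy G L)) :=
  ⟨exists_program_firstPlayerWins, exists_program_grundy, fun _ _ _ hG _ hne hL =>
    P3Game.grundy_eq_nimSum_branchGrundy hG hne hL⟩
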